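/- **Definitions.** A *cubic configuration* consists of eight base circles (lines allowed) in the plane, indexed by the vertices of a cube, and six dual circles, indexed by its faces. The base circles are pairwise tangent or disjoint, and tangent exactly when the vertices are adjacent; the dual circles are pairwise tangent or disjoint, and tangent exactly when the faces share an edge; a base circle and a dual circle are orthogonal if the vertex lies on the face, and disjoint otherwise. The base circles are oriented so that they bound disks with disjoint interiors, at most one of the curvatures being negative (a line has curvature $0$). The *cubic packing* $\mathcal A$ generated by the configuration is the orbit of the base circles under the group generated by the reflections across the six dual circles; the eight base circles of any configuration generating $\mathcal A$ are called an *octuple* of $\mathcal A$. The packing is *integral* if all its curvatures are integers, *primitive* if moreover their greatest common divisor is $1$, and of *type $(0,1,2)$* if the residues mod $4$ of its curvatures are exactly $0,1,2$. Let $\mathcal A$ be a primitive integral cubic packing of type $(0,1,2)$. Let $\mathcal C\in\mathcal A$ have curvature $a\ne 0$, and let $b,d,e$ be the curvatures of the three circles tangent to $\mathcal C$ in an octuple of $\mathcal A$ containing $\mathcal C$. Put $$Q(x,y)=(a+b)x^2-(a+b+d-e)xy+(a+d)y^2 ,$$ and let $\rho=Q(x,y)$, with $x,y\in\mathbb Z$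 coprime and $y\ge 0$, be coprime to $a$. With $\left(\frac{\cdot}{\cdot}\right)$ the Kronecker symbol, define $$\chi_2(\mathcal C)=\begin{cases}\left(\frac{\rho}{a}\right) & a\equiv 0,1 \pmod 4,\\[2pt] \left(\frac{-\rho}{a/2}\right) & a\equiv 2 \pmod 4.\end{cases}$$ This value does not depend on the choices made, nor on the circle $\mathcal C\in\mathcal A$ of nonzero curvature; it is denoted $\chi_2(\mathcal A)$. (In the hypothesis below it suffices that the value $-1$ occurs for one circle and one choice of octuple and of $\rho$.) An integer $n$ *satisfies the modular restrictions* of $\mathcal A$ if for every $m\ge 1$ it is congruent mod $m$ to the curvature of some circle of $\mathcal A$. The *Local-Global Conjecture* for $\mathcal A$ says that every sufficiently large integer satisfying the modular restrictions of $\mathcal A$ is the curvature of a circle of $\mathcal A$. **Theorem.** Let $\mathcal A$ be a primitive integral cubic packing of type $(0,1,2)$ with $\chi_2(\mathcal A)=-1$. Then no integer of the form $n^2$ or $2n^2$ with $n\in\mathbb Z$ is the curvature of a circle of $\mathcal A$. In particular, the Local-Global Conjecture is false for $\mathcal A$. -/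

import Mathlib

namespace CubicPacking

/-! ### Oriented generalized circles in inversive coordinates -/

/-- An oriented generalized circle (circle or line) of the plane, in inversive coordinates.
For a circle, `curv` is the (signed) reciprocal of the radius and `(h₁, h₂)` is the centre
multiplied by `curv`; a line has `curv = 0` and unit normal vector `(h₁, h₂)`.  The coordinate
`cocurv` is the curvature of the image under inversion in the unit circle.  The oriented disk
bounded by the circle is `curv * |z|² - 2 (h₁ x + h₂ y) + cocurv < 0`. -/
@[ext]
structure OrientedCircle where
  cocurv : ℝ
  curv : ℝ
  h₁ : ℝ
  h₂ : ℝ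
  norm_eq : h₁ ^ 2 + h₂ ^ 2 - curv * cocurv = 1

namespace OrientedCircle

/-- The symmetric bilinear form polarizing `h₁² + h₂² - curv * cocurv`.  Its value is `0` exactly
when the circles are orthogonal, `±1` when they are tangent (or equal), and it has absolute value
larger than `1` exactly when they are disjoint.  The values `-1` and `< -1` mean that the circles
are tangent, respectively disjoint, and their orientations are opposed, as is the case for two
circles bounding disks with disjoint interiors. -/
noncomputable def form (C D : OrientedCircle) : ℝ :=
  C.h₁ * D.h₁ + C.h₂ * D.h₂ - (C.curv * D.cocurv + C.cocurv * D.curv) / 2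

/-- The reflection (inversion) of `C` across `D`, that is `C - 2 ⟨C, D⟩ D`. -/
noncomputable def reflect (D C : OrientedCircle) : OrientedCircle where
  cocurv := C.cocurv - 2 * form C D * D.cocurv
  curv := C.curv - 2 * form C D * D.curv
  h₁ := C.h₁ - 2 * form C D * D.h₁
  h₂ := C.h₂ - 2 * form C D * D.h₂
  norm_eq := by
    have hC := C.norm_eq
    have hD := D.norm_eq
    unfold form
    linear_combination hC + 4 * (C.h₁ * D.h₁ + C.h₂ * D.h₂ -
      (C.curv * D.cocurv + C.cocurv * D.curv) / 2) ^ 2 * hD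

theorem reflect_reflect (D C : OrientedCircle) : reflect D (reflect D C) = C := by
  have hD := D.norm_eq
  have key : form (reflect D C) D = - form C D := by
    simp only [form, reflect]
    linear_combination (-2) * (C.h₁ * D.h₁ + C.h₂ * D.h₂ -
      (C.curv * D.cocurv + C.cocurv * D.curv) / 2) * hD
  ext
  · change (C.cocurv - 2 * form C D * D.cocurv) - 2 * form (reflect D C) D * D.cocurv = _
    rw [key]; ring
  · change (C.curv - 2 * form C D * D.curv) - 2 * form (reflect D C) D * D.curv = _
    rw [key]; ring
  · change (C.h₁ - 2 * form C D * D.h₁) - 2 * form (reflect D C) D * D.h₁ = _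
    rw [key]; ring
  · change (C.h₂ - 2 * form C D * D.h₂) - 2 * form (reflect D C) D * D.h₂ = _
    rw [key]; ring

/-- The reflection across `D` as a permutation of the set of oriented generalized circles. -/
noncomputable def reflection (D : OrientedCircle) : Equiv.Perm OrientedCircle where
  toFun := reflect D
  invFun := reflect D
  left_inv := reflect_reflect D
  right_inv := reflect_reflect D

end OrientedCircle

/-! ### The cube -/

/-- The eight vertices of the cube. -/
abbrev Vertex : Type := Fin 3 → Bool

/-- The neighbour of `v` along the edge of the cube in direction `i`. -/
def flip (v : Vertex) (i : Fin 3) : Vertex := Function.update v i (!(v i))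

/-- Adjacency in the graph of the cube. -/
def VertexAdj (u v : Vertex) : Prop := ∃ i : Fin 3, v = flip u i

/-- The six faces of the cube: the face `(i, s)` consists of the vertices `v` with `v i = s`. -/
abbrev Face : Type := Fin 3 × Bool

/-- Incidence of a vertex and a face of the cube. -/
def Incident (v : Vertex) (F : Face) : Prop := v F.1 = F.2

/-- Two distinct faces of the cube are adjacent (share an edge) if they are not opposite. -/
def FaceAdj (F G : Face) : Prop := F.1 ≠ G.1

/-! ### Cubic packings -/

/-- A base configuration of eight circles (an octuple) whose tangency graph is the graph of the
cube, with its dual configuration of six circles, whose tangency graph is the dual graph (that of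
the octahedron).  A base circle is orthogonal to a dual circle if they correspond to an incident
vertex/face pair, and the two are disjoint otherwise.  The base circles are oriented in the
standard way: their disks have disjoint interiors and at most one of them has negative curvature.
The orientation of the dual circles is immaterial. -/
structure CubicConfiguration where
  base : Vertex → OrientedCircle
  dual : Face → OrientedCircle
  base_tangent : ∀ u v, VertexAdj u v → (base u).form (base v) = -1
  base_disjoint : ∀ u v, u ≠ v → ¬ VertexAdj u v → (base u).form (base v) < -1
  dual_tangent : ∀ F G, FaceAdj F G → |(dual F).form (dual G)| = 1
  dual_disjoint : ∀ F G, F ≠ G → ¬ FaceAdj F G → 1 < |(dual F).form (dual G)|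
  orthogonal : ∀ v F, Incident v F → (base v).form (dual F) = 0
  disjoint : ∀ v F, ¬ Incident v F → 1 < |(base v).form (dual F)|
  oriented : ∀ u v, (base u).curv < 0 → (base v).curv < 0 → u = v

/-- The cubic Apollonian group, generated by the reflections across the dual circles. -/
noncomputable def CubicConfiguration.group (K : CubicConfiguration) :
    Subgroup (Equiv.Perm OrientedCircle) :=
  Subgroup.closure (Set.range fun F : Face => (K.dual F).reflection)

/-- The packing: the orbit of the base circles under the Apollonian group. -/
def CubicConfiguration.packing (K : CubicConfiguration) : Set OrientedCircle :=
  {C | ∃ g ∈ K.group, ∃ v : Vertex, C = g (K.base v)}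

/-- `A` is a cubic circle packing. -/
def IsCubicPacking (A : Set OrientedCircle) : Prop :=
  ∃ K : CubicConfiguration, K.packing = A

/-- The integers that appear as curvatures in `A`. -/
def curvatures (A : Set OrientedCircle) : Set ℤ :=
  {n | ∃ C ∈ A, C.curv = (n : ℝ)}

/-- All curvatures are integers. -/
def IsIntegral (A : Set OrientedCircle) : Prop :=
  ∀ C ∈ A, ∃ n : ℤ, C.curv = (n : ℝ)

/-- The greatest common divisor of all the curvatures is `1`. -/
def IsPrimitive (A : Set OrientedCircle) : Prop :=
  ∀ d : ℤ, (∀ n ∈ curvatures A, d ∣ n) → IsUnit d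

/-- Type `(0,1,2)`: the residues modulo `4` of the curvatures are exactly `0`, `1`, `2`. -/
def IsType012 (A : Set OrientedCircle) : Prop :=
  (fun n : ℤ => n % 4) '' curvatures A = {0, 1, 2}

/-! ### The quadratic invariant -/

/-- The Kronecker symbol `(a / b)` for `b ≠ 0`: multiplicative in `b`, it is the Legendre symbol
at odd primes, `(a / 2)` is `1`, `-1`, `0` for `a ≡ ±1`, `a ≡ ±3` mod `8`, `a` even, and
`(a / -1)` is `1` for `a ≥ 0` and `-1` for `a < 0`. -/
def kronecker (a b : ℤ) : ℤ :=
  (if a < 0 ∧ b < 0 then -1 else 1) * ZMod.χ₈ (a : ZMod 8) ^ padicValNat 2 b.natAbs *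
    jacobiSym a (b.natAbs / 2 ^ padicValNat 2 b.natAbs)

/-- The quadratic form `Q(x, y)` at a circle of curvature `a`, where `b`, `d`, `e` are the
curvatures of the three circles tangent to it in an octuple.  The circles of the packing tangent
to the given circle have curvatures `Q(x, y) - a` for coprime `x`, `y`. -/
def tangentForm (a b d e x y : ℤ) : ℤ :=
  (a + b) * x ^ 2 - (a + b + d - e) * x * y + (a + d) * y ^ 2

/-- `χ₂` of a circle of curvature `a` computed from an integer `ρ` coprime to `a` which is
represented by its quadratic form. -/
def chiValue (a ρ : ℤ) : ℤ :=
  if a % 4 = 2 then kronecker (-ρ) (a / 2) else kronecker ρ a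

/-- `χ₂(C) = ε` for the circle `C` of nonzero curvature `a` in the packing `A`: there is an
octuple of circles of `A` (a base configuration generating `A`) containing `C`, in which the
circles tangent to `C` have curvatures `b`, `d`, `e`, and an integer `ρ = Q(x, y)` coprime to `a`,
with `x`, `y` coprime and `y ≥ 0`, for which the formula defining `χ₂` has the value `ε`. -/
def CircleChi (A : Set OrientedCircle) (C : OrientedCircle) (ε : ℤ) : Prop :=
  ∃ (K : CubicConfiguration) (v : Vertex) (a b d e x y : ℤ),
    K.packing = A ∧ K.base v = C ∧ (K.base v).curv = a ∧
    (K.base (flip v 0)).curv = b ∧ (K.base (flip v 1)).curv = d ∧ (K.base (flip v 2)).curv = e ∧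
    a ≠ 0 ∧ IsCoprime x y ∧ 0 ≤ y ∧ IsCoprime (tangentForm a b d e x y) a ∧
    chiValue a (tangentForm a b d e x y) = ε

/-- `χ₂(A) = ε`, the value being taken at some circle of the packing.  (The value does not depend
on the circle or on the other choices for `A` of type `(0,1,2)`, but that is not built in.) -/
def PackingChi (A : Set OrientedCircle) (ε : ℤ) : Prop :=
  ∃ C ∈ A, CircleChi A C ε

/-! ### The Local-Global Conjecture -/

/-- `n` satisfies the modular restrictions of the packing `A`: modulo every positive integer it
is congruent to the curvature of some circle in `A`. -/
def IsAdmissible (A : Set OrientedCircle) (n : ℤ) : Prop :=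
  ∀ m : ℤ, 0 < m → ∃ k ∈ curvatures A, k ≡ n [ZMOD m]

/-- The Local-Global Conjecture for the packing `A`: every sufficiently large integer satisfying
the modular restrictions appears as a curvature. -/
def LocalGlobal (A : Set OrientedCircle) : Prop :=
  ∃ N : ℤ, ∀ n : ℤ, N ≤ n → IsAdmissible A n → n ∈ curvatures A

end CubicPacking

/-!
The theorem rests on a quadratic invariant of the packing that takes the value `1` at every circle
whose curvature is a square or twice a square.

*Geometry.* In inversive coordinates the circles are vectors of `ℝ⁴` with a form of signature
`(3, 1)`.  The tangency conditions make a cubic configuration rigid (`IsCubeFrame.scale_sq`): its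
base circles form an affine cube, and the curvatures `a` of a circle and `b`, `d`, `e` of its
neighbours determine all others and satisfy `(a + b + d - e)² - 4 (a + b) (a + d) = -8 a²`.  Hence
the curvatures of the packing are the first entries of the quadruples obtained from one quadruple
by relabelling the cube and by reflections (`ReachableOctuple`), and everything else is arithmetic
of such quadruples.

*The invariant.* The binary form `tangentForm` at a circle of curvature `a` has discriminant
`-8 a²`, so the product of two of its values has the form `X² + 2 a² Y²`.  Therefore `chiValue` does
not depend on the value `ρ` that is used (`chiValue_eq_of_mul_eq`).  For tangent circles of coprime
curvatures `a` and `b` one can use `ρ = a + b` at both, and the invariants agree by quadratic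
reciprocity (`chiValue_add_comm`).  The condition at the prime `2` that this needs is that odd
values of the form are `1` or `3` modulo `8`, which holds since `-2` is a square modulo such a value.
If the curvatures have a common factor, then the two circles are two corners of infinitely many
cycles of four tangent circles, and for a suitable cycle the other three sides have coprime
curvatures (`OctupleSystem.exists_coprime_path`); if `a` and `b` are both odd, the opposite side
joins two even curvatures, and is treated before.  So the invariant is the same at all circles
(`OctupleSystem.octupleChi_cross`).  It is `1` if `a` is a square or twice a square.  A line cannot
occur if the invariant is `-1`, as the circles tangent to a line have square curvature.

*Local obstructions.* It remains to see that infinitely many squares satisfy the modular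
restrictions.  Starting from a circle of curvature `a` divisible by `4` with an odd neighbour, two
steps of tangency reach every residue class of integers `t ≡ a` modulo `8` that are divisible by the
odd primes dividing `3 a` (`OctupleSystem.exists_congr`), and there are infinitely many squares `t`
of this kind.
-/

namespace CubicPacking

/-! ### Kronecker symbols and quadratic reciprocity -/

theorem exists_eq_two_pow_mul_odd_int {b : ℤ} (hb : b ≠ 0) :
    ∃ v : ℕ, ∃ m : ℤ, Odd m ∧ b = 2 ^ v * m := by
  obtain ⟨v, m, hm, h⟩ := Nat.exists_eq_two_pow_mul_odd (Int.natAbs_ne_zero.2 hb)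
  rcases Int.natAbs_eq b with h' | h'
  · exact ⟨v, m, by exact_mod_cast hm, by rw [h', h]; push_cast; ring⟩
  · exact ⟨v, -m, by simpa using hm, by rw [h', h]; push_cast; ring⟩

theorem kronecker_two_pow_mul (a : ℤ) {m : ℤ} (v : ℕ) (hm : Odd m) :
    kronecker a (2 ^ v * m) =
      (if a < 0 ∧ m < 0 then -1 else 1) * ZMod.χ₈ (a : ZMod 8) ^ v * jacobiSym a m.natAbs := by
  have hm' : Odd m.natAbs := Int.natAbs_odd.2 hm
  have hm0 : m.natAbs ≠ 0 := fun h => by simp [h] at hm'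
  have h1 : (2 ^ v * m).natAbs = 2 ^ v * m.natAbs := by
    rw [Int.natAbs_mul, Int.natAbs_pow]; rfl
  have h2 : padicValNat 2 (2 ^ v * m.natAbs) = v := by
    rw [padicValNat.mul (by positivity) hm0, padicValNat.prime_pow,
      padicValNat.eq_zero_of_not_dvd hm'.not_two_dvd_nat, add_zero]
  have h3 : (2 ^ v * m < 0) ↔ m < 0 := by
    rw [mul_neg_iff]
    have : (0 : ℤ) < 2 ^ v := by positivity
    constructor
    · rintro (h | h)
      · exact h.2
      · exact absurd h.1 (not_lt.2 this.le)
    · exact fun h => Or.inl ⟨this, h⟩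
  unfold kronecker
  rw [h1, h2, Nat.mul_div_cancel_left _ (by positivity)]
  simp only [h3]

theorem chi_eight_sq {a : ℤ} (ha : Odd a) : ZMod.χ₈ (a : ZMod 8) ^ 2 = 1 := by
  have := Int.odd_iff.1 ha
  rw [ZMod.χ₈_int_eq_if_mod_eight]
  split_ifs <;> omega

/-- Quadratic reciprocity for integers that are not both negative, one of which is `1` modulo
`4`. -/
theorem jacobiSym_natAbs_comm {m b : ℤ} (hm : Odd m) (hb : b % 4 = 1) (h : 0 < m ∨ 0 < b) :
    jacobiSym b m.natAbs = jacobiSym m b.natAbs := by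
  have hm' : Odd m.natAbs := Int.natAbs_odd.2 hm
  rcases lt_or_ge 0 b with hb0 | hb0
  · lift b to ℕ using hb0.le
    have hb4 : b % 4 = 1 := by omega
    have hbo : Odd b := Nat.odd_iff.2 (by omega)
    rw [Int.natAbs_natCast, jacobiSym.quadratic_reciprocity_one_mod_four hb4 hm']
    rcases Int.natAbs_eq m with h' | h'
    · rw [← h']
    · conv_rhs => rw [h', jacobiSym.neg _ hbo, ZMod.χ₄_nat_eq_if_mod_four]
      have : b % 2 = 1 := by omega
      simp [hb4, this]
  · have hm0 : 0 < m := by rcases h with h | h <;> omega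
    lift m to ℕ using hm0.le
    obtain ⟨c, rfl⟩ : ∃ c : ℕ, b = -(c : ℤ) := ⟨b.natAbs, by omega⟩
    have hc : c % 4 = 3 := by omega
    have hmo : Odd m := by exact_mod_cast hm
    have hco : Odd c := Nat.odd_iff.2 (by omega)
    rw [Int.natAbs_neg, Int.natAbs_natCast, Int.natAbs_natCast, jacobiSym.neg _ hmo,
      ZMod.χ₄_nat_eq_if_mod_four]
    have hm2 := Nat.odd_iff.1 hmo
    rcases (by omega : m % 4 = 1 ∨ m % 4 = 3) with h4 | h4
    · rw [jacobiSym.quadratic_reciprocity_one_mod_four h4 hco]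
      simp [h4, hm2]
    · rw [jacobiSym.quadratic_reciprocity_three_mod_four h4 hc]
      simp [h4, hm2]

theorem jacobiSym_add_right_natAbs (a b : ℤ) {m : ℤ} (h : m ∣ a) :
    jacobiSym (a + b) m.natAbs = jacobiSym b m.natAbs := by
  apply jacobiSym.mod_left'
  exact (Int.modEq_iff_dvd.2 (by simpa using h)).symm

theorem kronecker_odd {a m : ℤ} (ha : 0 ≤ a) (hm : Odd m) :
    kronecker a m = jacobiSym a m.natAbs := by
  have := kronecker_two_pow_mul a 0 hm
  simpa [not_lt.2 ha] using this

theorem jacobiSym_two_natAbs {b : ℤ} (hb : Odd b) :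
    jacobiSym 2 b.natAbs = ZMod.χ₈ (b : ZMod 8) := by
  have hb' : Odd b.natAbs := Int.natAbs_odd.2 hb
  have h2 := Int.odd_iff.1 hb
  rw [jacobiSym.at_two hb', ZMod.χ₈_nat_eq_if_mod_eight, ZMod.χ₈_int_eq_if_mod_eight]
  rcases Int.natAbs_eq b with h | h <;> split_ifs <;> first | rfl | omega

/-- Reciprocity across a tangency of circles of curvatures `a` and `b`, with `b` odd. -/
theorem chiValue_add_comm_of_odd {a b : ℤ} (ha0 : a ≠ 0) (ha : a % 4 = 0 ∨ a % 4 = 1 ∨ a % 4 = 2)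
    (hb : b % 4 = 1) (hab : 0 < a + b)
    (h8 : Odd (a + b) → (a + b) % 8 = 1 ∨ (a + b) % 8 = 3) :
    chiValue a (a + b) = chiValue b (a + b) := by
  have hbo : Odd b := Int.odd_iff.2 (by omega)
  have hR : chiValue b (a + b) = jacobiSym a b.natAbs := by
    rw [chiValue, if_neg (by omega), kronecker_odd hab.le hbo, add_comm,
      jacobiSym_add_right_natAbs _ _ dvd_rfl]
  rw [hR]
  rcases ha with ha | ha | ha
  · obtain ⟨v, m, hm, rfl⟩ := exists_eq_two_pow_mul_odd_int ha0
    have hm2 := Int.odd_iff.1 hm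
    have hv : 2 ≤ v := by
      rcases v with _ | _ | v
      · omega
      · omega
      · omega
    have hmb : 0 < m ∨ 0 < b := by
      by_contra! hcon
      have : 2 ^ v * m ≤ 0 := mul_nonpos_of_nonneg_of_nonpos (by positivity) hcon.1
      omega
    rw [chiValue, if_neg (by omega), kronecker_two_pow_mul _ _ hm, if_neg (by omega), one_mul,
      jacobiSym_add_right_natAbs _ _ (Dvd.intro_left _ rfl), jacobiSym_natAbs_comm hm hb hmb,
      jacobiSym.mul_left, jacobiSym.pow_left, jacobiSym_two_natAbs hbo]
    congr 1
    rcases hv.eq_or_lt with rfl | hv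
    · rw [chi_eight_sq hbo, chi_eight_sq (Int.odd_iff.2 (by omega))]
    · obtain ⟨k, rfl⟩ := Nat.exists_eq_add_of_le hv
      have : ((2 ^ (2 + 1 + k) * m + b : ℤ) : ZMod 8) = (b : ZMod 8) := by
        rw [ZMod.intCast_eq_intCast_iff]
        refine (Int.modEq_iff_dvd.2 ⟨-(2 ^ k * m), by push_cast; ring⟩)
      rw [this]
  · have hao : Odd a := Int.odd_iff.2 (by omega)
    rw [chiValue, if_neg (by omega), kronecker_odd hab.le hao,
      jacobiSym_add_right_natAbs _ _ dvd_rfl, jacobiSym_natAbs_comm hao hb (by omega)]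
  · obtain ⟨m, rfl⟩ : ∃ m, a = 2 * m := ⟨a / 2, by omega⟩
    have hm : Odd m := Int.odd_iff.2 (by omega)
    have h8 := h8 (Int.odd_iff.2 (by omega))
    have hm' : Odd m.natAbs := Int.natAbs_odd.2 hm
    have hk := kronecker_two_pow_mul (-(2 * m + b)) 0 hm
    rw [pow_zero, one_mul, pow_zero, mul_one] at hk
    rw [chiValue, if_pos ha, Int.mul_ediv_cancel_left _ two_ne_zero, hk, jacobiSym.neg _ hm',
      jacobiSym_add_right_natAbs _ _ (Dvd.intro_left _ rfl),
      jacobiSym_natAbs_comm hm hb (by omega), jacobiSym.mul_left, jacobiSym_two_natAbs hbo,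
      ← mul_assoc]
    congr 1
    rw [ZMod.χ₄_nat_eq_if_mod_four, ZMod.χ₈_int_eq_if_mod_eight]
    split_ifs <;> omega

/-- Reciprocity across a tangency of circles of coprime curvatures `a` and `b`. -/
theorem chiValue_add_comm {a b : ℤ} (ha0 : a ≠ 0) (hb0 : b ≠ 0)
    (ha : a % 4 = 0 ∨ a % 4 = 1 ∨ a % 4 = 2) (hb : b % 4 = 0 ∨ b % 4 = 1 ∨ b % 4 = 2)
    (hcop : IsCoprime a b) (hab : 0 < a + b)
    (h8 : Odd (a + b) → (a + b) % 8 = 1 ∨ (a + b) % 8 = 3) :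
    chiValue a (a + b) = chiValue b (a + b) := by
  have hodd : b % 4 = 1 ∨ a % 4 = 1 := by
    by_contra! h
    have h2 : IsUnit (2 : ℤ) := hcop.isUnit_of_dvd' (by omega) (by omega)
    exact absurd h2 (by decide)
  rcases hodd with h | h
  · exact chiValue_add_comm_of_odd ha0 ha h hab h8
  · rw [add_comm a b] at hab h8 ⊢
    exact (chiValue_add_comm_of_odd hb0 hb h hab h8).symm

theorem jacobiSym_natAbs_mul_eq_one {ρ σ m X : ℤ} (hρ : IsCoprime ρ m) (hσ : IsCoprime σ m)
    (h : m ∣ ρ * σ - X ^ 2) : jacobiSym ρ m.natAbs * jacobiSym σ m.natAbs = 1 := by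
  have hX : IsCoprime (X ^ 2) m := by
    obtain ⟨k, hk⟩ := h
    have : X ^ 2 = ρ * σ + m * (-k) := by linear_combination -hk
    rw [this]
    exact (IsCoprime.add_mul_left_left_iff).2 (hρ.mul_left hσ)
  have hX' : X.gcd (m.natAbs : ℤ) = 1 := by
    rw [Int.gcd, Int.natAbs_natCast, ← Int.gcd]
    exact Int.isCoprime_iff_gcd_eq_one.1 ((IsCoprime.pow_left_iff (by norm_num)).1 hX)
  rw [← jacobiSym.mul_left, ← jacobiSym.sq_one' hX']
  exact jacobiSym.mod_left' (Int.modEq_iff_dvd.2 (Int.natAbs_dvd.2 h)).symm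

/-- `chiValue a ρ` only depends on the genus of `ρ`: it takes the same value at two integers
whose product is represented by `X² + 2 a² Y²`. -/
theorem chiValue_eq_of_mul_eq {a ρ σ X Y : ℤ} (ha0 : a ≠ 0) (hρ : 0 ≤ ρ) (hσ : 0 ≤ σ)
    (hρa : IsCoprime ρ a) (hσa : IsCoprime σ a) (h : ρ * σ = X ^ 2 + 2 * a ^ 2 * Y ^ 2) :
    chiValue a ρ = chiValue a σ := by
  have key : ∀ x y : ℤ, IsUnit y → x * y = 1 → x = y := by
    intro x y hy hxy
    rcases Int.isUnit_iff.1 hy with rfl | rfl <;> omega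
  have key' : ∀ x y : ℤ, x * y = 1 → x = y :=
    fun x y hxy => key x y (IsUnit.of_mul_eq_one x (by rwa [mul_comm])) hxy
  unfold chiValue
  split_ifs with h4
  · obtain ⟨m, rfl⟩ : ∃ m, a = 2 * m := ⟨a / 2, by omega⟩
    have hm : Odd m := Int.odd_iff.2 (by omega)
    have hm' : Odd m.natAbs := Int.natAbs_odd.2 hm
    have ne0 : ∀ τ : ℤ, IsCoprime τ (2 * m) → τ ≠ 0 := by
      rintro τ hτ rfl
      exact absurd (hτ.isUnit_of_dvd' (dvd_zero 2) (Dvd.intro _ rfl)) (by decide)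
    have hρ0 := ne0 ρ hρa
    have hσ0 := ne0 σ hσa
    have hk := fun τ => kronecker_two_pow_mul τ 0 hm
    simp only [pow_zero, one_mul, mul_one] at hk
    rw [Int.mul_ediv_cancel_left _ two_ne_zero, hk, hk]
    have e1 : (-ρ < 0 ∧ m < 0) ↔ (-σ < 0 ∧ m < 0) := by constructor <;> rintro ⟨h1, h2⟩ <;> omega
    rw [if_congr e1 rfl rfl]
    congr 1
    apply key'
    refine jacobiSym_natAbs_mul_eq_one (X := X) hρa.of_mul_right_right.neg_left
      hσa.of_mul_right_right.neg_left ⟨8 * m * Y ^ 2, by linear_combination h⟩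
  · obtain ⟨v, m, hm, rfl⟩ := exists_eq_two_pow_mul_odd_int ha0
    rw [kronecker_two_pow_mul _ _ hm, kronecker_two_pow_mul _ _ hm, if_neg (by omega),
      if_neg (by omega)]
    have hJ : jacobiSym ρ m.natAbs = jacobiSym σ m.natAbs := by
      apply key'
      exact jacobiSym_natAbs_mul_eq_one (X := X) hρa.of_mul_right_right
        hσa.of_mul_right_right ⟨2 * 2 ^ v * 2 ^ v * m * Y ^ 2, by linear_combination h⟩
    rw [hJ]
    congr 2
    rcases v with _ | v
    · simp
    · have h2 : ∀ τ : ℤ, IsCoprime τ (2 ^ (v + 1) * m) → Odd τ := fun τ hτ =>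
        Int.isCoprime_two_right.1 (hτ.of_isCoprime_of_dvd_right ⟨2 ^ v * m, by ring⟩)
      have hρo := h2 _ hρa
      have hσo := h2 _ hσa
      -- an odd integer of the form `X² + 2 a² Y²` with `4 ∣ a` is `1` modulo `8`
      have h8 : (ρ * σ) % 8 = 1 := by
        have h4' : (2 ^ (v + 1) * m) % 4 = 0 := by
          have : (2 ^ (v + 1) * m) = 2 * (2 ^ v * m) := by ring
          omega
        obtain ⟨w, hw⟩ := Int.dvd_of_emod_eq_zero h4'
        rw [hw] at h
        have hX : Odd X := by
          have := hρo.mul hσo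
          rw [h] at this
          by_contra hX
          rw [Int.not_odd_iff_even] at hX
          obtain ⟨t, rfl⟩ := hX
          rw [Int.odd_iff] at this
          ring_nf at this
          omega
        have := Int.sq_mod_four_eq_one_of_odd hX
        obtain ⟨t, rfl⟩ := hX
        have he : (t * (t + 1)) % 2 = 0 := Int.even_iff.1 (Int.even_mul_succ_self t)
        have : ρ * σ = 4 * (t * (t + 1)) + 8 * (4 * w ^ 2 * Y ^ 2) + 1 := by rw [h]; ring
        omega
      have h1 : ZMod.χ₈ (ρ : ZMod 8) * ZMod.χ₈ (σ : ZMod 8) = 1 := by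
        rw [← map_mul, ← Int.cast_mul, ZMod.χ₈_int_eq_if_mod_eight]
        rw [if_neg (by omega), if_pos (Or.inl h8)]
      rw [key' _ _ h1]

theorem jacobiSym_sq_right {ρ n : ℤ} (h : IsCoprime ρ n) : jacobiSym ρ (n ^ 2).natAbs = 1 := by
  rw [Int.natAbs_pow, jacobiSym.pow_right]
  refine jacobiSym.sq_one ?_
  rw [Int.gcd, Int.natAbs_natCast, ← Int.gcd]
  exact Int.isCoprime_iff_gcd_eq_one.1 h

theorem chiValue_sq {n ρ : ℤ} (hn : n ≠ 0) (hρ : 0 ≤ ρ) (h : IsCoprime ρ (n ^ 2)) :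
    chiValue (n ^ 2) ρ = 1 := by
  have h4 : ¬ (n ^ 2) % 4 = 2 := by
    rcases Int.even_or_odd' n with ⟨k, rfl | rfl⟩ <;> ring_nf <;> omega
  rw [chiValue, if_neg h4]
  obtain ⟨v, m, hm, rfl⟩ := exists_eq_two_pow_mul_odd_int hn
  have e : (2 ^ v * m) ^ 2 = 2 ^ (2 * v) * m ^ 2 := by ring
  rw [e] at h ⊢
  rw [kronecker_two_pow_mul _ _ (hm.pow), if_neg (by omega), one_mul,
    jacobiSym_sq_right ((IsCoprime.pow_right_iff two_pos).1 h.of_mul_right_right), mul_one, pow_mul]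
  rcases v with _ | v
  · simp
  · rw [chi_eight_sq, one_pow]
    exact Int.isCoprime_two_right.1
      (h.of_mul_right_left.of_isCoprime_of_dvd_right (dvd_pow_self 2 (by omega)))

theorem chiValue_two_mul_sq {n ρ : ℤ} (hn : n ≠ 0) (hρ : 0 ≤ ρ) (h : IsCoprime ρ (2 * n ^ 2))
    (h8' : Even n → ρ % 8 = 1) : chiValue (2 * n ^ 2) ρ = 1 := by
  rcases Int.even_or_odd n with hn2 | hn2
  · have h8 := h8' hn2
    have h4 : ¬ (2 * n ^ 2) % 4 = 2 := by
      obtain ⟨k, rfl⟩ := hn2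
      ring_nf; omega
    rw [chiValue, if_neg h4]
    obtain ⟨v, m, hm, rfl⟩ := exists_eq_two_pow_mul_odd_int hn
    have e : 2 * (2 ^ v * m) ^ 2 = 2 ^ (2 * v + 1) * m ^ 2 := by ring
    rw [e] at h ⊢
    rw [kronecker_two_pow_mul _ _ (hm.pow), if_neg (by omega), one_mul,
      jacobiSym_sq_right ((IsCoprime.pow_right_iff two_pos).1 h.of_mul_right_right), mul_one,
      ZMod.χ₈_int_eq_if_mod_eight, if_neg (by omega),
      if_pos (Or.inl h8), one_pow]
  · have h4 : (2 * n ^ 2) % 4 = 2 := by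
      obtain ⟨k, rfl⟩ := hn2
      ring_nf; omega
    have hk := kronecker_two_pow_mul (-ρ) 0 (hn2.pow (n := 2))
    rw [pow_zero, one_mul, pow_zero, mul_one, if_neg (by intro h; nlinarith [sq_nonneg n, h.2]),
      one_mul] at hk
    rw [chiValue, if_pos h4, Int.mul_ediv_cancel_left _ two_ne_zero, hk]
    exact jacobiSym_sq_right
      ((IsCoprime.pow_right_iff two_pos).1 h.of_mul_right_right).neg_left

/-- An odd positive divisor of `X² + 2 a²` that is coprime to `a` is `1` or `3` modulo `8`. -/
theorem mod_eight_of_dvd_sq_add {A a X : ℤ} (hA : 0 < A) (hodd : Odd A) (hcop : IsCoprime A a)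
    (h : A ∣ X ^ 2 + 2 * a ^ 2) : A % 8 = 1 ∨ A % 8 = 3 := by
  have h2 : IsCoprime A 2 := Int.isCoprime_two_right.2 hodd
  have hA2 : IsCoprime (-2 * a ^ 2) A :=
    (h2.symm.neg_left).mul_left (hcop.symm.pow_left)
  have hX : IsCoprime X A := by
    obtain ⟨k, hk⟩ := h
    have : IsCoprime (X ^ 2) A := by
      have e : X ^ 2 = -2 * a ^ 2 + A * k := by linear_combination hk
      rw [e]; exact IsCoprime.add_mul_left_left_iff.2 hA2
    exact (IsCoprime.pow_left_iff two_pos).1 this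
  lift A to ℕ using hA.le
  have hodd' : Odd A := by exact_mod_cast hodd
  have e1 : jacobiSym (-2 * a ^ 2) A = 1 := by
    rw [← jacobiSym.sq_one' (Int.isCoprime_iff_gcd_eq_one.1 hX)]
    apply jacobiSym.mod_left'
    exact Int.modEq_iff_dvd.2 (by convert h using 1; ring)
  rw [jacobiSym.mul_left, jacobiSym.sq_one' (Int.isCoprime_iff_gcd_eq_one.1 hcop.symm), mul_one,
    jacobiSym.at_neg_two hodd', ZMod.χ₈'_nat_eq_if_mod_eight] at e1
  have := Nat.odd_iff.1 hodd'
  split_ifs at e1 with h1 h2 <;> omega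

/-! ### Tangency forms of octuples -/

/-- A family of quadruples `(a, b, d, e)` with the properties of the curvatures of a circle and
of the three circles tangent to it in an octuple, for the octuples of a fixed primitive integral
packing of type `(0,1,2)`.  It is closed under exchanging the three neighbours, under passing to
a neighbour in the octuple, and under the reflection fixing all but one neighbour; `rel` says
that `tangentForm` has discriminant `-8 a²`. -/
structure OctupleSystem (S : ℤ → ℤ → ℤ → ℤ → Prop) : Prop where
  swap : ∀ {a b d e}, S a b d e → S a d b e
  swap' : ∀ {a b d e}, S a b d e → S a b e d
  cross : ∀ {a b d e}, S a b d e → S b a (b + d - a) (b + e - a)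
  reflect : ∀ {a b d e}, S a b d e → S a (2 * a + 2 * d + 2 * e - b) d e
  rel : ∀ {a b d e}, S a b d e → (a + b + d - e) ^ 2 - 4 * (a + b) * (a + d) = -8 * a ^ 2
  nonneg : ∀ {a b d e}, S a b d e → 0 ≤ a + b
  prim : ∀ {a b d e}, S a b d e → ∀ {g}, g ∣ a → g ∣ b → g ∣ d → g ∣ e → IsUnit g
  parity : ∀ {a b d e}, S a b d e → 2 ∣ a + b → 2 ∣ a + d → ¬ 2 ∣ a + e
  mod_four : ∀ {a b d e}, S a b d e → a % 4 = 0 ∨ a % 4 = 1 ∨ a % 4 = 2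

/-- The value `ε` is taken by `chiValue` at some properly represented value of `tangentForm`. -/
def OctupleChi (a b d e ε : ℤ) : Prop :=
  ∃ x y : ℤ, IsCoprime x y ∧ IsCoprime (tangentForm a b d e x y) a ∧
    chiValue a (tangentForm a b d e x y) = ε

theorem octupleChi_of_substitution {a b d e b' d' e' ε : ℤ} (f : ℤ → ℤ → ℤ × ℤ)
    (hf : ∀ x y, IsCoprime x y → IsCoprime (f x y).1 (f x y).2)
    (h : ∀ x y, tangentForm a b' d' e' (f x y).1 (f x y).2 = tangentForm a b d e x y)
    (H : OctupleChi a b d e ε) : OctupleChi a b' d' e' ε := by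
  obtain ⟨x, y, h1, h2, h3⟩ := H
  exact ⟨(f x y).1, (f x y).2, hf x y h1, by rwa [h], by rwa [h]⟩

theorem OctupleChi.swap {a b d e ε : ℤ} (H : OctupleChi a b d e ε) : OctupleChi a d b e ε :=
  octupleChi_of_substitution (fun x y => (y, x)) (fun _ _ h => h.symm)
    (fun x y => by simp only [tangentForm]; ring) H

theorem OctupleChi.swap' {a b d e ε : ℤ} (H : OctupleChi a b d e ε) : OctupleChi a b e d ε :=
  octupleChi_of_substitution (fun x y => (x - y, -y))
    (fun x y h => by
      obtain ⟨u, v, h⟩ := h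
      exact ⟨u, -u - v, by linear_combination h⟩)
    (fun x y => by simp only [tangentForm]; ring) H

theorem OctupleChi.reflect {a b d e ε : ℤ} (H : OctupleChi a b d e ε) :
    OctupleChi a (2 * a + 2 * d + 2 * e - b) d e ε :=
  octupleChi_of_substitution (fun x y => (x, 2 * x - y))
    (fun x y h => by
      obtain ⟨u, v, h⟩ := h
      exact ⟨u + 2 * v, -v, by linear_combination h⟩)
    (fun x y => by simp only [tangentForm]; ring) H

/-- Invariance under the parabolic motions fixing the first neighbour. -/
theorem octupleChi_shift {a b d e ε : ℤ} (k : ℤ) :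
    OctupleChi a b (tangentForm a b d e k 1 - a) (tangentForm a b d e (k + 1) 1 - a) ε ↔
      OctupleChi a b d e ε := by
  constructor
  · refine octupleChi_of_substitution (fun x y => (x + k * y, y)) (fun x y h => ?_)
      (fun x y => by simp only [tangentForm]; ring)
    exact IsCoprime.add_mul_right_left_iff.2 h
  · refine octupleChi_of_substitution (fun x y => (x - k * y, y)) (fun x y h => ?_)
      (fun x y => by simp only [tangentForm]; ring)
    rw [sub_eq_add_neg, ← neg_mul]
    exact IsCoprime.add_mul_right_left_iff.2 h

theorem isCoprime_of_forall_prime {x y : ℤ}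
    (h : ∀ p : ℕ, p.Prime → (p : ℤ) ∣ x → ¬ (p : ℤ) ∣ y) : IsCoprime x y := by
  rw [Int.isCoprime_iff_gcd_eq_one]
  by_contra hg
  obtain ⟨p, hp, hpg⟩ := Nat.exists_prime_and_dvd hg
  exact h p hp ((Int.natCast_dvd_natCast.2 hpg).trans (Int.gcd_dvd_left ..))
    ((Int.natCast_dvd_natCast.2 hpg).trans (Int.gcd_dvd_right ..))

/-- Chinese remainder theorem for powers of the primes dividing `M`. -/
theorem exists_forall_pow_dvd_sub (M : ℕ) (e : ℕ → ℕ) (r : ℕ → ℤ) :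
    ∃ k : ℕ, ∀ p ∈ M.primeFactors, (p : ℤ) ^ e p ∣ k - r p := by
  have hpos : ∀ p ∈ M.primeFactors, p ^ e p ≠ 0 := fun p hp =>
    pow_ne_zero _ (Nat.prime_of_mem_primeFactors hp).ne_zero
  obtain ⟨k, hk⟩ := Nat.chineseRemainderOfFinset (fun p => (r p % (p : ℤ) ^ e p).toNat)
    (fun p => p ^ e p) M.primeFactors hpos (by
      intro p hp q hq hpq
      exact Nat.Coprime.pow _ _ ((Nat.coprime_primes (Nat.prime_of_mem_primeFactors hp)
        (Nat.prime_of_mem_primeFactors hq)).2 hpq))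
  refine ⟨k, fun p hp => ?_⟩
  have h1 := (Nat.modEq_iff_dvd.1 (hk p hp).symm)
  have h0 : (p : ℤ) ^ e p ≠ 0 := by exact_mod_cast hpos p hp
  rw [Int.toNat_of_nonneg (Int.emod_nonneg _ h0)] at h1
  push_cast at h1
  have h2 : (p : ℤ) ^ e p ∣ r p % (p : ℤ) ^ e p - r p := by
    have := Int.mul_ediv_add_emod (r p) ((p : ℤ) ^ e p)
    exact ⟨-(r p / (p : ℤ) ^ e p), by linear_combination this⟩
  simpa using dvd_add h1 h2

theorem tangentForm_sub_dvd {a b d e p x y x' y' : ℤ} (hx : p ∣ x - x') (hy : p ∣ y - y') :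
    p ∣ tangentForm a b d e x y - tangentForm a b d e x' y' := by
  obtain ⟨u, hu⟩ := hx
  obtain ⟨v, hv⟩ := hy
  obtain rfl : x = x' + p * u := by linear_combination hu
  obtain rfl : y = y' + p * v := by linear_combination hv
  simp only [tangentForm]
  refine ⟨(a + b) * (2 * x' * u + p * u ^ 2) - (a + b + d - e) * (x' * v + u * y' + p * u * v) +
    (a + d) * (2 * y' * v + p * v ^ 2), by ring⟩

namespace OctupleSystem

variable {S : ℤ → ℤ → ℤ → ℤ → Prop} (hS : OctupleSystem S) {a b d e : ℤ}
include hS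

theorem exists_half (h : S a b d e) :
    ∃ B, a + b + d - e = 2 * B ∧ (a + b) * (a + d) = B ^ 2 + 2 * a ^ 2 := by
  have hr := hS.rel h
  have h2 : Even (a + b + d - e) := by
    have : Even ((a + b + d - e) ^ 2) :=
      ⟨2 * (a + b) * (a + d) - 4 * a ^ 2, by linear_combination hr⟩
    exact (Int.even_pow' two_ne_zero).1 this
  obtain ⟨B, hB⟩ := h2
  refine ⟨B, by rw [hB]; ring, ?_⟩
  rw [hB] at hr
  linarith

theorem pos (h : S a b d e) (ha : a ≠ 0) : 0 < a + b := by
  obtain ⟨B, -, hB⟩ := hS.exists_half h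
  refine lt_of_le_of_ne (hS.nonneg h) fun h0 => ?_
  rw [← h0] at hB
  have := sq_nonneg B
  have : 0 < a ^ 2 := by positivity
  linarith

theorem tangentForm_nonneg (h : S a b d e) (ha : a ≠ 0) (x y : ℤ) :
    0 ≤ tangentForm a b d e x y := by
  obtain ⟨B, hB, hr⟩ := hS.exists_half h
  have hA := hS.pos h ha
  have : (a + b) * tangentForm a b d e x y = ((a + b) * x - B * y) ^ 2 + 2 * a ^ 2 * y ^ 2 := by
    rw [tangentForm, hB]
    linear_combination y ^ 2 * hr
  exact nonneg_of_mul_nonneg_right (by rw [this]; positivity) hA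

theorem chiValue_eq (h : S a b d e) (ha : a ≠ 0) {x y z w : ℤ}
    (h1 : IsCoprime (tangentForm a b d e x y) a) (h2 : IsCoprime (tangentForm a b d e z w) a) :
    chiValue a (tangentForm a b d e x y) = chiValue a (tangentForm a b d e z w) := by
  obtain ⟨B, hB, hr⟩ := hS.exists_half h
  refine chiValue_eq_of_mul_eq (X := (a + b) * x * z - B * (x * w + y * z) + (a + d) * y * w)
    (Y := x * w - y * z) ha
    (hS.tangentForm_nonneg h ha x y) (hS.tangentForm_nonneg h ha z w) h1 h2 ?_
  simp only [tangentForm, hB]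
  linear_combination (x * w - y * z) ^ 2 * hr

theorem mod_eight (h : S a b d e) (ha : a ≠ 0) (hab : IsCoprime a b) (hodd : Odd (a + b)) :
    (a + b) % 8 = 1 ∨ (a + b) % 8 = 3 := by
  obtain ⟨B, -, hB⟩ := hS.exists_half h
  refine mod_eight_of_dvd_sq_add (hS.pos h ha) hodd ?_ (Dvd.intro _ hB)
  have : IsCoprime (b + a * 1) a := IsCoprime.add_mul_left_left_iff.2 hab.symm
  rwa [mul_one, add_comm] at this

/-- Passing to a neighbour of coprime curvature preserves the invariant. -/
theorem octupleChi_cross_of_isCoprime (h : S a b d e) (ha : a ≠ 0) (hb : b ≠ 0)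
    (hab : IsCoprime a b) {ε : ℤ} (H : OctupleChi a b d e ε) :
    OctupleChi b a (b + d - a) (b + e - a) ε := by
  obtain ⟨x, y, -, h1, h2⟩ := H
  have e1 : tangentForm a b d e 1 0 = a + b := by simp [tangentForm]
  have e2 : tangentForm b a (b + d - a) (b + e - a) 1 0 = a + b := by
    simp [tangentForm, add_comm]
  have c1 : IsCoprime (a + b) a := by
    have : IsCoprime (b + a * 1) a := IsCoprime.add_mul_left_left_iff.2 hab.symm
    rwa [mul_one, add_comm] at this
  have c2 : IsCoprime (a + b) b := by
    have : IsCoprime (a + b * 1) b := IsCoprime.add_mul_left_left_iff.2 hab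
    rwa [mul_one] at this
  refine ⟨1, 0, isCoprime_one_left, by rwa [e2], ?_⟩
  rw [e2, ← chiValue_add_comm ha hb (hS.mod_four h) (hS.mod_four (hS.cross h)) hab (hS.pos h ha)
    (hS.mod_eight h ha hab), ← h2, ← e1]
  exact hS.chiValue_eq h ha (by rwa [e1]) h1

theorem shift (h : S a b d e) (k : ℕ) :
    S a b (tangentForm a b d e k 1 - a) (tangentForm a b d e (k + 1) 1 - a) := by
  induction k with
  | zero =>
    convert h using 1 <;> simp [tangentForm]
    ring
  | succ k ih =>
    convert hS.swap' (hS.swap (hS.reflect (hS.swap ih))) using 1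
    · simp
    · simp only [tangentForm]
      push_cast
      ring

omit hS in
theorem exists_not_dvd_of_double_root {p A B u : ℤ} {Q : ℤ → ℤ} (hp : Prime p) (hA : ¬ p ∣ A)
    (h : ∀ k, p ∣ A * (Q k - u) - (A * k - B) ^ 2) : ∃ r, ¬ p ∣ Q r - u := by
  by_contra! hcon
  have hk : ∀ k, p ∣ A * k - B := fun k => by
    refine hp.dvd_of_dvd_pow (n := 2) ?_
    have := dvd_sub ((hcon k).mul_left A) (h k)
    simpa using this
  refine hA ?_
  have := dvd_sub (hk 1) (hk 0)
  simpa using this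

/-- The residues modulo an odd prime for which the cycle of four circles used in
`octupleChi_cross_of_path` has curvatures that are coprime at `p` along its sides. -/
theorem exists_local_path (h : S a b d e) {p : ℤ} (hp : Prime p) (hp2 : ¬ p ∣ 2)
    (hpab : p ∣ a ∨ p ∣ b ∨ p ∣ b - a) :
    ∃ r : ℤ, (p ∣ a → ¬ p ∣ tangentForm a b d e r 1) ∧
      (p ∣ b → ¬ p ∣ tangentForm a b d e r 1 - 2 * a) ∧
      (p ∣ b - a → ¬ p ∣ tangentForm a b d e r 1 - a) := by
  obtain ⟨B, hB, hr⟩ := hS.exists_half h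
  have hQ : ∀ k, tangentForm a b d e k 1 = (a + b) * k ^ 2 - 2 * B * k + (a + d) := by
    intro k; rw [tangentForm, hB]; ring
  have hAQ : ∀ k u, (a + b) * (tangentForm a b d e k 1 - u) - ((a + b) * k - B) ^ 2 =
      2 * a ^ 2 - (a + b) * u := by
    intro k u; rw [hQ]; linear_combination hr
  by_cases ha : p ∣ a
  · by_cases hb : p ∣ b
    · have hpB : p ∣ B := by
        refine hp.dvd_of_dvd_pow (n := 2) ?_
        have : B ^ 2 = (a + b) * (a + d) - a * (2 * a) := by linear_combination -hr
        rw [this]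
        exact dvd_sub ((dvd_add ha hb).mul_right _) (ha.mul_right _)
      have hd : ¬ p ∣ d := by
        intro hd
        refine hp.not_isUnit (hS.prim h ha hb hd ?_)
        have : e = a + b + d - 2 * B := by linear_combination -hB
        rw [this]
        exact dvd_sub (dvd_add (dvd_add ha hb) hd) (hpB.mul_left _)
      refine ⟨0, fun _ hc => hd ?_, fun _ hc => hd ?_, fun _ hc => hd ?_⟩ <;> rw [hQ] at hc <;>
        ring_nf at hc
      · exact (dvd_add_right ha).1 hc
      · have := dvd_add ha hc
        ring_nf at this
        exact this
      · exact hc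
    · have hA : ¬ p ∣ a + b := fun hc => hb ((dvd_add_right ha).1 hc)
      obtain ⟨r, hr'⟩ := exists_not_dvd_of_double_root (u := 0) (B := B)
        (Q := fun k => tangentForm a b d e k 1) hp hA (fun k => by
          rw [hAQ]; exact dvd_sub ((ha.pow two_ne_zero).mul_left 2) (by simp))
      exact ⟨r, fun _ => by simpa using hr', fun hb' => absurd hb' hb,
        fun hba => absurd ((dvd_sub_left ha).1 hba) hb⟩
  · by_cases hb : p ∣ b
    · have hA : ¬ p ∣ a + b := fun hc => ha ((dvd_add_left hb).1 hc)
      obtain ⟨r, hr'⟩ := exists_not_dvd_of_double_root (u := 2 * a) (B := B)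
        (Q := fun k => tangentForm a b d e k 1) hp hA (fun k => by
          rw [hAQ]
          have : 2 * a ^ 2 - (a + b) * (2 * a) = b * (-2 * a) := by ring
          rw [this]; exact hb.mul_right _)
      exact ⟨r, fun ha' => absurd ha' ha, fun _ => hr',
        fun hba => absurd ((dvd_sub_right hb).1 hba) ha⟩
    · have hba : p ∣ b - a := by tauto
      have hA : ¬ p ∣ a + b := by
        intro hc
        have h2 : p ∣ 2 * a := by
          have := dvd_sub hc hba
          ring_nf at this
          rwa [mul_comm]
        exact (hp.dvd_or_dvd h2).elim hp2 ha
      obtain ⟨r, hr'⟩ := exists_not_dvd_of_double_root (u := a) (B := B)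
        (Q := fun k => tangentForm a b d e k 1) hp hA (fun k => by
          rw [hAQ]
          have : 2 * a ^ 2 - (a + b) * a = (b - a) * (-a) := by ring
          rw [this]; exact hba.mul_right _)
      exact ⟨r, fun ha' => absurd ha' ha, fun hb' => absurd hb' hb, fun _ => hr'⟩

theorem exists_odd_value (h : S a b d e) : ∃ r : ℤ, ¬ 2 ∣ tangentForm a b d e r 1 := by
  obtain ⟨B, hB, -⟩ := hS.exists_half h
  have hp := hS.parity h
  by_contra! hcon
  have h0 := hcon 0
  have h1 := hcon 1
  rw [tangentForm, hB] at h0 h1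
  refine hp ?_ ?_ ?_ <;> omega

/-- Two tangent circles of curvatures `a ≠ b` lie on a cycle of four tangent circles of
curvatures `a`, `d'`, `b + d' - a`, `b` that are coprime along the remaining sides (except possibly
at the prime `2` for the side opposite to the given one). -/
theorem exists_coprime_path (h : S a b d e) (ha : a ≠ 0) (hb : b ≠ 0) (hne : a ≠ b) :
    ∃ k : ℕ, IsCoprime a (tangentForm a b d e k 1 - a) ∧
      IsCoprime (b + (tangentForm a b d e k 1 - a) - a) b ∧
      Odd (tangentForm a b d e k 1) ∧
      (¬ (Odd a ∧ Odd b) → IsCoprime (tangentForm a b d e k 1 - a)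
        (b + (tangentForm a b d e k 1 - a) - a)) := by
  have hM : a * b * (b - a) ≠ 0 := mul_ne_zero (mul_ne_zero ha hb) (sub_ne_zero.2 hne.symm)
  have hM2 : 2 * (a * b * (b - a)) ≠ 0 := mul_ne_zero two_ne_zero hM
  have hex : ∀ p : ℕ, ∃ r : ℤ, p.Prime → (p : ℤ) ∣ a * b * (b - a) →
      (p ≠ 2 → ((p : ℤ) ∣ a → ¬ (p : ℤ) ∣ tangentForm a b d e r 1) ∧
      ((p : ℤ) ∣ b → ¬ (p : ℤ) ∣ tangentForm a b d e r 1 - 2 * a) ∧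
      ((p : ℤ) ∣ b - a → ¬ (p : ℤ) ∣ tangentForm a b d e r 1 - a)) := by
    intro p
    by_cases hp : p.Prime ∧ (p : ℤ) ∣ a * b * (b - a) ∧ p ≠ 2
    · obtain ⟨hp, hd, h2⟩ := hp
      have hp' := Nat.prime_iff_prime_int.1 hp
      obtain ⟨r, hr⟩ := hS.exists_local_path h hp'
        (fun hc => h2 ((Nat.prime_dvd_prime_iff_eq hp Nat.prime_two).1 (by exact_mod_cast hc)))
        (by
          rcases hp'.dvd_or_dvd hd with hd | hd
          · rcases hp'.dvd_or_dvd hd with hd | hd <;> tauto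
          · tauto)
      exact ⟨r, fun _ _ _ => hr⟩
    · exact ⟨0, fun h1 h2 h3 => absurd ⟨h1, h2, h3⟩ hp⟩
  choose r hr using hex
  obtain ⟨r₂, hr₂⟩ := hS.exists_odd_value h
  obtain ⟨k, hk⟩ := exists_forall_pow_dvd_sub (2 * (a * b * (b - a))).natAbs (fun _ => 1)
    (fun p => if p = 2 then r₂ else r p)
  have hodd : ¬ 2 ∣ tangentForm a b d e k 1 := by
    have h2 := hk 2 (Nat.mem_primeFactors.2 ⟨Nat.prime_two,
      Int.natAbs_dvd_natAbs.2 (Dvd.intro _ rfl : (2 : ℤ) ∣ _), Int.natAbs_ne_zero.2 hM2⟩)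
    simp only [if_true, pow_one] at h2
    have := tangentForm_sub_dvd (a := a) (b := b) (d := d) (e := e) h2
      (by simp : ((2 : ℕ) : ℤ) ∣ 1 - 1)
    push_cast at this
    omega
  have hk' : ∀ p : ℕ, p.Prime → p ≠ 2 → ((p : ℤ) ∣ a * b * (b - a)) →
      (p : ℤ) ∣ tangentForm a b d e k 1 - tangentForm a b d e (r p) 1 := by
    intro p hp hp2 hd
    have h2 := hk p (Nat.mem_primeFactors.2 ⟨hp,
      Int.natCast_dvd.1 (hd.mul_left 2), Int.natAbs_ne_zero.2 hM2⟩)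
    simp only [if_neg hp2, pow_one] at h2
    exact tangentForm_sub_dvd h2 (by simp)
  refine ⟨k, isCoprime_of_forall_prime fun p hp h1 h2 => ?_,
    isCoprime_of_forall_prime fun p hp h1 h2 => ?_, Int.odd_iff.2 (by omega),
    fun hab => isCoprime_of_forall_prime fun p hp h1 h2 => ?_⟩
  · have h3 : (p : ℤ) ∣ tangentForm a b d e k 1 := by simpa using dvd_add h2 h1
    by_cases hp2 : p = 2
    · subst hp2; exact hodd (by exact_mod_cast h3)
    · have hd : (p : ℤ) ∣ a * b * (b - a) := (h1.mul_right _).mul_right _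
      exact (hr p hp hd hp2).1 h1 (by simpa using dvd_sub h3 (hk' p hp hp2 hd))
  · have h3 : (p : ℤ) ∣ tangentForm a b d e k 1 - 2 * a := by
      have := dvd_sub h1 h2
      ring_nf at this ⊢
      exact this
    by_cases hp2 : p = 2
    · subst hp2
      push_cast at h3
      omega
    · have hd : (p : ℤ) ∣ a * b * (b - a) := (h2.mul_left _).mul_right _
      refine (hr p hp hd hp2).2.1 h2 ?_
      have := dvd_sub h3 (hk' p hp hp2 hd)
      ring_nf at this ⊢
      exact this
  · have h3 : (p : ℤ) ∣ b - a := by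
      have := dvd_sub h2 h1
      ring_nf at this ⊢
      exact this
    by_cases hp2 : p = 2
    · subst hp2
      push_cast at h1 h3
      exact hab ⟨Int.odd_iff.2 (by omega), Int.odd_iff.2 (by omega)⟩
    · have hd : (p : ℤ) ∣ a * b * (b - a) := h3.mul_left _
      refine (hr p hp hd hp2).2.2 h3 ?_
      have := dvd_sub h1 (hk' p hp hp2 hd)
      ring_nf at this ⊢
      exact this

/-- The invariant is carried from `a` to `b` along the three remaining sides of a cycle of four
tangent circles, if the side opposite to the given one carries it. -/
theorem octupleChi_cross_of_path (h : S a b d e) (ha : a ≠ 0) (hb : b ≠ 0) (hd : d ≠ 0)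
    (hf : b + d - a ≠ 0) (had : IsCoprime a d) (hfb : IsCoprime (b + d - a) b) {ε : ℤ}
    (hmid : OctupleChi d (b + d - a) a (d + e - a) ε →
      OctupleChi (b + d - a) d b (b + d + e - 2 * a) ε)
    (H : OctupleChi a b d e ε) : OctupleChi b a (b + d - a) (b + e - a) ε := by
  have s1 : S d (b + d - a) a (d + e - a) := by
    convert hS.swap (hS.cross (hS.swap h)) using 1; ring
  have s2 : S (b + d - a) b d (b + d + e - 2 * a) := by
    convert hS.swap (hS.cross s1) using 1 <;> ring
  have H1 : OctupleChi d (b + d - a) a (d + e - a) ε := by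
    convert (hS.octupleChi_cross_of_isCoprime (hS.swap h) ha hd had H.swap).swap using 1; ring
  have H2 := (hmid H1).swap
  convert (hS.octupleChi_cross_of_isCoprime s2 hf hb hfb H2).swap using 1 <;> ring

omit hS in
theorem octupleChi_cross_shift {ε : ℤ} (k : ℤ) :
    OctupleChi b a (b + (tangentForm a b d e k 1 - a) - a)
      (b + (tangentForm a b d e (k + 1) 1 - a) - a) ε ↔
      OctupleChi b a (b + d - a) (b + e - a) ε := by
  have e1 : ∀ k : ℤ, b + (tangentForm a b d e k 1 - a) - a =
      tangentForm b a (b + d - a) (b + e - a) k 1 - b := by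
    intro k; simp only [tangentForm]; ring
  rw [e1, e1, octupleChi_shift]

theorem octupleChi_cross_of_not_odd (h : S a b d e) (ha : a ≠ 0) (hb : b ≠ 0)
    (hab : ¬ (Odd a ∧ Odd b)) {ε : ℤ} (H : OctupleChi a b d e ε) :
    OctupleChi b a (b + d - a) (b + e - a) ε := by
  by_cases hcop : IsCoprime a b
  · exact hS.octupleChi_cross_of_isCoprime h ha hb hcop H
  by_cases hne : a = b
  · subst hne
    convert H using 1 <;> ring
  obtain ⟨k, had, hfb, -, hdf⟩ := hS.exists_coprime_path h ha hb hne
  have hsh := hS.shift h k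
  rw [← octupleChi_cross_shift (k : ℤ)]
  rw [← octupleChi_shift (k : ℤ)] at H
  set d' := tangentForm a b d e k 1 - a
  set e' := tangentForm a b d e (k + 1) 1 - a
  have hd : d' ≠ 0 := by
    intro h0
    rw [h0] at had
    exact hcop (had.of_isCoprime_of_dvd_right (dvd_zero _))
  have hf : b + d' - a ≠ 0 := by
    intro h0
    rw [h0] at hfb
    exact hcop (hfb.of_isCoprime_of_dvd_left (dvd_zero _))
  refine hS.octupleChi_cross_of_path hsh ha hb hd hf had hfb (fun H' => ?_) H
  have s1 : S d' (b + d' - a) a (d' + e' - a) := by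
    convert hS.swap (hS.cross (hS.swap hsh)) using 1; ring
  convert hS.octupleChi_cross_of_isCoprime s1 hd hf (hdf hab) H' using 1 <;> ring

/-- Passing to a neighbour preserves the invariant. -/
theorem octupleChi_cross (h : S a b d e) (ha : a ≠ 0) (hb : b ≠ 0) {ε : ℤ}
    (H : OctupleChi a b d e ε) : OctupleChi b a (b + d - a) (b + e - a) ε := by
  by_cases hab : Odd a ∧ Odd b
  swap
  · exact hS.octupleChi_cross_of_not_odd h ha hb hab H
  by_cases hcop : IsCoprime a b
  · exact hS.octupleChi_cross_of_isCoprime h ha hb hcop H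
  by_cases hne : a = b
  · subst hne
    convert H using 1 <;> ring
  obtain ⟨k, had, hfb, hodd, -⟩ := hS.exists_coprime_path h ha hb hne
  have hsh := hS.shift h k
  rw [← octupleChi_cross_shift (k : ℤ)]
  rw [← octupleChi_shift (k : ℤ)] at H
  have hd2 : Even (tangentForm a b d e k 1 - a) := hodd.sub_odd hab.1
  set d' := tangentForm a b d e k 1 - a
  set e' := tangentForm a b d e (k + 1) 1 - a
  have hd : d' ≠ 0 := by
    intro h0
    rw [h0] at had
    exact hcop (had.of_isCoprime_of_dvd_right (dvd_zero _))
  have hf : b + d' - a ≠ 0 := by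
    intro h0
    rw [h0] at hfb
    exact hcop (hfb.of_isCoprime_of_dvd_left (dvd_zero _))
  refine hS.octupleChi_cross_of_path hsh ha hb hd hf had hfb (fun H' => ?_) H
  have s1 : S d' (b + d' - a) a (d' + e' - a) := by
    convert hS.swap (hS.cross (hS.swap hsh)) using 1; ring
  convert hS.octupleChi_cross_of_not_odd s1 hd hf
    (fun ho => (Int.not_odd_iff_even.2 hd2) ho.1) H' using 1 <;> ring

end OctupleSystem

/-! ### Circles tangent to a given circle, and squares -/

namespace OctupleSystem

variable {S : ℤ → ℤ → ℤ → ℤ → Prop} (hS : OctupleSystem S) {a b d e : ℤ}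
include hS

/-- Every primitive value of `tangentForm` comes from a circle tangent to the given one.  The
proof is Euclid's algorithm on superbases of `ℤ²`. -/
theorem exists_of_isCoprime (h : S a b d e) {x y : ℤ} (hxy : IsCoprime x y) :
    ∃ d' e', S a (tangentForm a b d e x y - a) d' e' := by
  induction hn : x.natAbs + y.natAbs using Nat.strong_induction_on generalizing b d e x y with
  | _ n ih =>
    subst hn
    have key : ∀ {b d e x y : ℤ}, S a b d e → IsCoprime x y → y.natAbs ≤ x.natAbs →
        (∀ m < x.natAbs + y.natAbs, ∀ {b d e : ℤ}, S a b d e → ∀ {x y : ℤ}, IsCoprime x y →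
          x.natAbs + y.natAbs = m → ∃ d' e', S a (tangentForm a b d e x y - a) d' e') →
        ∃ d' e', S a (tangentForm a b d e x y - a) d' e' := by
      intro b d e x y h hxy hle ih
      by_cases hy : y = 0
      · subst hy
        refine ⟨d, e, ?_⟩
        convert h using 1
        have hx : x ^ 2 = 1 := by
          rcases Int.isUnit_iff.1 (isCoprime_zero_right.1 hxy) with rfl | rfl <;> rfl
        simp only [tangentForm]
        linear_combination (a + b) * hx
      · rcases le_or_gt 0 (x * y) with hpos | hneg
        · have hlt : (x - y).natAbs + y.natAbs < x.natAbs + y.natAbs := by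
            rcases lt_or_gt_of_ne hy with hy' | hy'
            · have : x ≤ 0 := by nlinarith
              omega
            · have : 0 ≤ x := by nlinarith
              omega
          have hc : IsCoprime (x - y) y := by
            have : IsCoprime (x + y * (-1)) y := IsCoprime.add_mul_left_left_iff.2 hxy
            convert this using 1; ring
          obtain ⟨d', e', h'⟩ := ih _ hlt (hS.shift h 1) hc rfl
          refine ⟨d', e', ?_⟩
          convert h' using 1
          simp only [tangentForm]
          push_cast
          ring
        · have hlt : (x + y).natAbs + y.natAbs < x.natAbs + y.natAbs := by
            rcases lt_or_gt_of_ne hy with hy' | hy'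
            · have : 0 ≤ x := by nlinarith
              omega
            · have : x ≤ 0 := by nlinarith
              omega
          have hc : IsCoprime (x + y) y := by
            have : IsCoprime (x + y * 1) y := IsCoprime.add_mul_left_left_iff.2 hxy
            convert this using 1; ring
          obtain ⟨d', e', h'⟩ := ih _ hlt
            (hS.swap (hS.reflect (hS.swap (hS.swap' h)))) hc rfl
          refine ⟨d', e', ?_⟩
          convert h' using 1
          simp only [tangentForm]
          ring
    rcases le_total y.natAbs x.natAbs with hle | hle
    · exact key h hxy hle ih
    · obtain ⟨d', e', h'⟩ := key (hS.swap h) hxy.symm hle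
        (fun m hm => by rw [add_comm] at hm; exact ih m hm)
      refine ⟨d', e', ?_⟩
      convert h' using 1
      simp only [tangentForm]
      ring

/-- A circle tangent to a line has square curvature. -/
theorem exists_sq_of_tangent_zero (h : S a 0 d e) : ∃ n, a = n ^ 2 := by
  have h' := hS.cross h
  obtain ⟨B, hB, hr⟩ := hS.exists_half h'
  have hcop : IsCoprime a (d - a) := by
    refine isCoprime_of_forall_prime fun p hp h1 h2 => ?_
    have hp' := Nat.prime_iff_prime_int.1 hp
    have hpB : (p : ℤ) ∣ B := by
      refine hp'.dvd_of_dvd_pow (n := 2) ?_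
      have : B ^ 2 = a * (d - a) := by linear_combination -hr
      rw [this]; exact h1.mul_right _
    refine hp'.not_isUnit (hS.prim h h1 (dvd_zero _) ?_ ?_)
    · simpa using dvd_add h2 h1
    · have : e = a + d - 2 * B := by linear_combination -hB
      rw [this]
      exact dvd_sub (dvd_add h1 (by simpa using dvd_add h2 h1)) (hpB.mul_left _)
  obtain ⟨n, hn | hn⟩ := Int.sq_of_isCoprime (c := B) hcop (by linear_combination hr)
  · exact ⟨n, hn⟩
  · have := hS.nonneg h
    refine ⟨0, ?_⟩
    nlinarith [sq_nonneg n]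

theorem chi_eq_one_of_sq (h : S a b d e) (ha : a ≠ 0) {n ε : ℤ} (hn : a = n ^ 2)
    (H : OctupleChi a b d e ε) : ε = 1 := by
  obtain ⟨x, y, -, h1, rfl⟩ := H
  have h2 := hS.tangentForm_nonneg h ha x y
  generalize tangentForm a b d e x y = ρ at h1 h2
  subst hn
  exact chiValue_sq (by rintro rfl; simp at ha) h2 h1

theorem chi_eq_one_of_two_mul_sq (h : S a b d e) (ha : a ≠ 0) {n ε : ℤ} (hn : a = 2 * n ^ 2)
    (H : OctupleChi a b d e ε) : ε = 1 := by
  obtain ⟨x, y, hxy, h1, rfl⟩ := H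
  have h2 := hS.tangentForm_nonneg h ha x y
  obtain ⟨d', e', h3⟩ := hS.exists_of_isCoprime h hxy
  generalize tangentForm a b d e x y = ρ at h1 h2 h3
  subst hn
  refine chiValue_two_mul_sq (by rintro rfl; simp at ha) h2 h1 fun hn => ?_
  have hodd : Odd ρ := Int.isCoprime_two_right.1
    (h1.of_isCoprime_of_dvd_right (Dvd.intro _ rfl))
  have hc : IsCoprime (2 * n ^ 2) (ρ - 2 * n ^ 2) := by
    have : IsCoprime (ρ + 2 * n ^ 2 * (-1)) (2 * n ^ 2) := IsCoprime.add_mul_left_left_iff.2 h1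
    convert this.symm using 1; ring
  have h8 := hS.mod_eight h3 ha hc (by simpa using hodd)
  have h4 := hS.mod_four (hS.cross h3)
  obtain ⟨k, rfl⟩ := hn
  have e8 : 2 * (k + k) ^ 2 = 8 * k ^ 2 := by ring
  rw [e8] at h4 h8
  rw [Int.odd_iff] at hodd
  omega

end OctupleSystem

/-- The quadruples of curvatures of a circle and its neighbours in an octuple that are obtained
from a given one by relabelling the cube and by reflections across dual circles. -/
inductive ReachableOctuple (a₀ b₀ d₀ e₀ : ℤ) : ℤ → ℤ → ℤ → ℤ → Prop
  | base : ReachableOctuple a₀ b₀ d₀ e₀ a₀ b₀ d₀ e₀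
  | swap {a b d e : ℤ} : ReachableOctuple a₀ b₀ d₀ e₀ a b d e →
      ReachableOctuple a₀ b₀ d₀ e₀ a d b e
  | swap' {a b d e : ℤ} : ReachableOctuple a₀ b₀ d₀ e₀ a b d e →
      ReachableOctuple a₀ b₀ d₀ e₀ a b e d
  | cross {a b d e : ℤ} : ReachableOctuple a₀ b₀ d₀ e₀ a b d e →
      ReachableOctuple a₀ b₀ d₀ e₀ b a (b + d - a) (b + e - a)
  | reflect {a b d e : ℤ} : ReachableOctuple a₀ b₀ d₀ e₀ a b d e →
      ReachableOctuple a₀ b₀ d₀ e₀ a (2 * a + 2 * d + 2 * e - b) d e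

namespace ReachableOctuple

variable {a₀ b₀ d₀ e₀ a b d e : ℤ}

/-- If the invariant is `-1` for one octuple, then it is `-1` for all of them, and no line
occurs: a line would be tangent to circles of square curvature, where the invariant is `1`. -/
theorem ne_zero_and_octupleChi (hS : OctupleSystem (ReachableOctuple a₀ b₀ d₀ e₀)) (h0 : a₀ ≠ 0)
    (H0 : OctupleChi a₀ b₀ d₀ e₀ (-1)) (h : ReachableOctuple a₀ b₀ d₀ e₀ a b d e) :
    a ≠ 0 ∧ OctupleChi a b d e (-1) := by
  induction h with
  | base => exact ⟨h0, H0⟩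
  | swap _ ih => exact ⟨ih.1, ih.2.swap⟩
  | swap' _ ih => exact ⟨ih.1, ih.2.swap'⟩
  | reflect _ ih => exact ⟨ih.1, ih.2.reflect⟩
  | @cross a b d e h ih =>
    have hb : b ≠ 0 := by
      rintro rfl
      obtain ⟨n, hn⟩ := hS.exists_sq_of_tangent_zero h
      exact absurd (hS.chi_eq_one_of_sq h ih.1 hn ih.2) (by norm_num)
    exact ⟨hb, hS.octupleChi_cross h ih.1 hb ih.2⟩

theorem not_sq (hS : OctupleSystem (ReachableOctuple a₀ b₀ d₀ e₀)) (h0 : a₀ ≠ 0)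
    (H0 : OctupleChi a₀ b₀ d₀ e₀ (-1)) (h : ReachableOctuple a₀ b₀ d₀ e₀ a b d e) (n : ℤ) :
    a ≠ n ^ 2 ∧ a ≠ 2 * n ^ 2 := by
  obtain ⟨ha, H⟩ := ne_zero_and_octupleChi hS h0 H0 h
  refine ⟨fun hn => ?_, fun hn => ?_⟩
  · exact absurd (hS.chi_eq_one_of_sq h ha hn H) (by norm_num)
  · exact absurd (hS.chi_eq_one_of_two_mul_sq h ha hn H) (by norm_num)

/-- The properties of all octuples follow from those of one, except for the condition modulo `4`,
which is not inherited. -/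
theorem octupleSystem (hrel : (a₀ + b₀ + d₀ - e₀) ^ 2 - 4 * (a₀ + b₀) * (a₀ + d₀) = -8 * a₀ ^ 2)
    (hb : 0 ≤ a₀ + b₀) (hd : 0 ≤ a₀ + d₀) (he : 0 ≤ a₀ + e₀)
    (hprim : ∀ g : ℤ, g ∣ a₀ → g ∣ b₀ → g ∣ d₀ → g ∣ e₀ → IsUnit g)
    (hpar : 2 ∣ a₀ + b₀ → 2 ∣ a₀ + d₀ → ¬ 2 ∣ a₀ + e₀)
    (h4 : ∀ a b d e, ReachableOctuple a₀ b₀ d₀ e₀ a b d e → a % 4 = 0 ∨ a % 4 = 1 ∨ a % 4 = 2) :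
    OctupleSystem (ReachableOctuple a₀ b₀ d₀ e₀) := by
  have hrel' : ∀ {a b d e}, ReachableOctuple a₀ b₀ d₀ e₀ a b d e →
      (a + b + d - e) ^ 2 - 4 * (a + b) * (a + d) = -8 * a ^ 2 := by
    intro a b d e h
    induction h with
    | base => exact hrel
    | _ h ih => linear_combination ih
  have hnonneg : ∀ {a b d e}, ReachableOctuple a₀ b₀ d₀ e₀ a b d e →
      0 ≤ a + b ∧ 0 ≤ a + d ∧ 0 ≤ a + e := by
    intro a b d e h
    induction h with
    | base => exact ⟨hb, hd, he⟩
    | swap _ ih => exact ⟨ih.2.1, ih.1, ih.2.2⟩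
    | swap' _ ih => exact ⟨ih.1, ih.2.2, ih.2.1⟩
    | @cross a b d e h ih =>
      have key : ∀ {d e : ℤ}, (a + b + d - e) ^ 2 - 4 * (a + b) * (a + d) = -8 * a ^ 2 →
          0 ≤ a + b → 0 ≤ a + d → 0 ≤ b + (b + d - a) := by
        intro d e hr h1 h2
        rcases h1.eq_or_lt with h1 | h1
        · rw [← h1] at hr
          have : a ^ 2 = 0 := by nlinarith [sq_nonneg a, sq_nonneg (0 + d - e)]
          have : a = 0 := by simpa using this
          subst this
          omega
        · have : 0 ≤ 4 * ((a + b) * (b + (b + d - a))) := by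
            have : 4 * ((a + b) * (b + (b + d - a))) = (a + b + d - e) ^ 2 + 8 * b ^ 2 := by
              linear_combination -hr
            rw [this]; positivity
          exact nonneg_of_mul_nonneg_right (by linarith) h1
      refine ⟨by linarith [ih.1], key (hrel' h) ih.1 ih.2.1,
        key (hrel' h.swap') ih.1 ih.2.2⟩
    | @reflect a b d e h ih =>
      refine ⟨?_, ih.2.1, ih.2.2⟩
      have hr := hrel' h
      rcases ih.1.eq_or_lt with h1 | h1
      · linarith [ih.2.1, ih.2.2]
      · have : (a + b) * (a + (2 * a + 2 * d + 2 * e - b)) = (d - e) ^ 2 + 8 * a ^ 2 := by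
          linear_combination -hr
        exact nonneg_of_mul_nonneg_right (by rw [this]; positivity) h1
  refine ⟨swap, swap', cross, reflect, hrel', fun h => (hnonneg h).1, ?_, ?_, h4 _ _ _ _⟩
  · intro a b d e h
    induction h with
    | base => exact fun {g} => hprim g
    | swap _ ih => exact fun h1 h2 h3 h4 => ih h1 h3 h2 h4
    | swap' _ ih => exact fun h1 h2 h3 h4 => ih h1 h2 h4 h3
    | cross _ ih =>
      intro g h1 h2 h3 h4
      refine ih h2 h1 ?_ ?_
      · have := dvd_sub (dvd_add h3 h2) h1
        ring_nf at this
        exact this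
      · have := dvd_sub (dvd_add h4 h2) h1
        ring_nf at this
        exact this
    | reflect _ ih =>
      intro g h1 h2 h3 h4
      refine ih h1 ?_ h3 h4
      have := dvd_sub (((h1.mul_left 2).add (h3.mul_left 2)).add (h4.mul_left 2)) h2
      ring_nf at this
      exact this
  · intro a b d e h
    induction h with
    | base => exact hpar
    | _ h ih => intros; omega

end ReachableOctuple

/-! ### Local solvability -/

theorem exists_sq_mul_congr_odd {p : ℕ} (hp : p.Prime) (hp2 : p ≠ 2) {r s : ℤ}
    (hr : ¬ (p : ℤ) ∣ r) (h : (p : ℤ) ∣ r - s) (k : ℕ) : ∃ l : ℤ, (p : ℤ) ^ k ∣ l ^ 2 * r - s := by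
  have hp' := Nat.prime_iff_prime_int.1 hp
  have hs : ¬ (p : ℤ) ∣ s := fun hs => hr (by simpa using dvd_add h hs)
  have h2 : ¬ (p : ℤ) ∣ 2 := fun hc =>
    hp2 ((Nat.prime_dvd_prime_iff_eq hp Nat.prime_two).1 (by exact_mod_cast hc))
  suffices H : ∃ l : ℤ, (p : ℤ) ^ (k + 1) ∣ l ^ 2 * r - s by
    obtain ⟨l, hl⟩ := H
    exact ⟨l, (pow_dvd_pow _ (Nat.le_succ k)).trans hl⟩
  induction k with
  | zero => exact ⟨1, by simpa using h⟩
  | succ k ih =>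
    obtain ⟨l, q, hq⟩ := ih
    have hl : ¬ (p : ℤ) ∣ l := by
      intro hl
      refine hs ?_
      have : s = l * (l * r) - p * (p ^ k * q) := by linear_combination -hq
      rw [this]
      exact dvd_sub (hl.mul_right _) (Dvd.intro _ rfl)
    have hc : IsCoprime (p : ℤ) (2 * l * r) := by
      rw [hp'.irreducible.coprime_iff_not_dvd]
      intro hd
      rcases hp'.dvd_or_dvd hd with hd | hd
      · exact (hp'.dvd_or_dvd hd).elim h2 hl
      · exact hr hd
    obtain ⟨u, v, huv⟩ := hc
    refine ⟨l - p ^ (k + 1) * (q * v), q * u + p ^ k * q ^ 2 * v ^ 2 * r, ?_⟩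
    linear_combination hq - p ^ (k + 1) * q * huv

theorem exists_sq_mul_congr_two {r s : ℤ} (hr : Odd r) (h : 8 ∣ r - s) (k : ℕ) :
    ∃ l : ℤ, (2 : ℤ) ^ k ∣ l ^ 2 * r - s := by
  have hs : Odd s := by rw [Int.odd_iff] at hr ⊢; omega
  suffices H : ∃ l : ℤ, (2 : ℤ) ^ (k + 3) ∣ l ^ 2 * r - s by
    obtain ⟨l, hl⟩ := H
    exact ⟨l, (pow_dvd_pow _ (by omega)).trans hl⟩
  induction k with
  | zero => exact ⟨1, by simpa using h⟩
  | succ k ih =>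
    obtain ⟨l, q, hq⟩ := ih
    have hl : Odd (l ^ 2 * r) := by
      have : l ^ 2 * r = s + 2 * (2 ^ (k + 2) * q) := by linear_combination hq
      rw [this]
      exact hs.add_even (even_two_mul _)
    have hlr : Even (1 + l * r) :=
      odd_one.add_odd (((Int.odd_pow' two_ne_zero).1 (Int.odd_mul.1 hl).1).mul hr)
    obtain ⟨w, hw⟩ := hlr
    refine ⟨l + 2 ^ (k + 2) * q, q * w + 2 ^ k * q ^ 2 * r, ?_⟩
    linear_combination hq + 2 ^ (k + 3) * q * hw

/-- Residues that are primitive at every prime dividing `M` are those of a coprime pair. -/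
theorem exists_isCoprime_congr (M : ℕ) (e : ℕ → ℕ) (he : ∀ p ∈ M.primeFactors, 1 ≤ e p)
    (u v : ℕ → ℤ) (huv : ∀ p ∈ M.primeFactors, (p : ℤ) ∣ u p → ¬ (p : ℤ) ∣ v p) :
    ∃ x y : ℤ, IsCoprime x y ∧
      ∀ p ∈ M.primeFactors, (p : ℤ) ^ e p ∣ x - u p ∧ (p : ℤ) ^ e p ∣ y - v p := by
  obtain ⟨x, hx⟩ := exists_forall_pow_dvd_sub M e u
  obtain ⟨y, hy⟩ := exists_forall_pow_dvd_sub M e v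
  set N : ℕ := ∏ p ∈ M.primeFactors, p ^ e p with hN
  have hN0 : 0 < N := Finset.prod_pos fun p hp =>
    pow_pos (Nat.prime_of_mem_primeFactors hp).pos _
  have hNd : ∀ p ∈ M.primeFactors, (p : ℤ) ^ e p ∣ (N : ℤ) := fun p hp => by
    have := Finset.dvd_prod_of_mem (fun p => p ^ e p) hp
    rw [← hN] at this
    exact_mod_cast this
  have hNp : ∀ q : ℕ, q.Prime → (q : ℤ) ∣ N → q ∈ M.primeFactors := by
    intro q hq hd
    obtain ⟨p, hp, hd⟩ := (Nat.prime_iff.1 hq).exists_mem_finset_dvd (Int.natCast_dvd_natCast.1 hd)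
    rwa [(Nat.prime_dvd_prime_iff_eq hq (Nat.prime_of_mem_primeFactors hp)).1
      (hq.dvd_of_dvd_pow hd)]
  have hy0 : y + N ≠ 0 := by omega
  -- shift `x` by a multiple of `N` that avoids the prime factors of `y + N` not dividing `N`
  obtain ⟨k, hk⟩ := exists_forall_pow_dvd_sub (y + N) (fun _ => 1)
    (fun q => if (q : ℤ) ∣ x then 1 else 0)
  have hx' : ∀ p ∈ M.primeFactors, (p : ℤ) ^ e p ∣ (x + N * k : ℤ) - u p := fun p hp => by
    have := dvd_add (hx p hp) ((hNd p hp).mul_right k)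
    exact this.trans (dvd_of_eq (by ring))
  have hy' : ∀ p ∈ M.primeFactors, (p : ℤ) ^ e p ∣ (y + N : ℤ) - v p := fun p hp => by
    have := dvd_add (hy p hp) (hNd p hp)
    exact this.trans (dvd_of_eq (by ring))
  refine ⟨x + N * k, y + N, isCoprime_of_forall_prime fun q hq h1 h2 => ?_,
    fun p hp => ⟨hx' p hp, hy' p hp⟩⟩
  have hq' := Nat.prime_iff_prime_int.1 hq
  by_cases hqN : (q : ℤ) ∣ N
  · have hqM := hNp q hq hqN
    have hqe : (q : ℤ) ∣ (q : ℤ) ^ e q := dvd_pow_self _ (by have := he q hqM; omega)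
    refine huv q hqM ?_ ?_
    · have := dvd_sub h1 (hqe.trans (hx' q hqM))
      simpa using this
    · have := dvd_sub h2 (hqe.trans (hy' q hqM))
      simpa using this
  · have hkq := hk q (Nat.mem_primeFactors.2 ⟨hq, by exact_mod_cast h2, hy0⟩)
    rw [pow_one] at hkq
    by_cases hqx : (q : ℤ) ∣ x
    · rw [if_pos hqx] at hkq
      have h3 : (q : ℤ) ∣ N * k := (dvd_add_right hqx).1 h1
      rcases hq'.dvd_or_dvd h3 with h3 | h3
      · exact hqN h3
      · have := dvd_sub h3 hkq
        simp only [sub_sub_cancel] at this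
        exact hq'.not_dvd_one this
    · rw [if_neg hqx, sub_zero] at hkq
      exact hqx ((dvd_add_left (hkq.mul_left _)).1 h1)

theorem dvd_of_forall_factorization {m : ℕ} (hm : m ≠ 0) {X : ℤ}
    (h : ∀ p ∈ m.primeFactors, (p : ℤ) ^ m.factorization p ∣ X) : (m : ℤ) ∣ X := by
  rw [← Nat.prod_factorization_pow_eq_self hm, Finsupp.prod, Nat.support_factorization]
  push_cast
  refine Finset.prod_dvd_of_coprime ?_ h
  · intro p hp q hq hpq
    simp only [Function.onFun, ← Nat.cast_pow]
    exact Nat.isCoprime_iff_coprime.2 (Nat.Coprime.pow _ _ ((Nat.coprime_primes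
      (Nat.prime_of_mem_primeFactors hp) (Nat.prime_of_mem_primeFactors hq)).2 hpq))

namespace OctupleSystem

variable {S : ℤ → ℤ → ℤ → ℤ → Prop} (hS : OctupleSystem S) {a b d e : ℤ}
include hS

/-- At odd primes not dividing `a` the form is nondegenerate, so it represents everything. -/
theorem exists_tangentForm_congr (h : S a b d e) {p : ℕ} (hp : p.Prime) (hp2 : p ≠ 2)
    (ha : ¬ (p : ℤ) ∣ a) (r : ℤ) : ∃ x y, (p : ℤ) ∣ tangentForm a b d e x y - r := by
  have := Fact.mk hp
  obtain ⟨B, hB, hr⟩ := hS.exists_half h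
  have ha' : (a : ZMod p) ≠ 0 := by rwa [Ne, ZMod.intCast_zmod_eq_zero_iff_dvd]
  have h2 : (2 : ZMod p) ≠ 0 := by
    have : ¬ (p : ℤ) ∣ 2 := fun hc =>
      hp2 ((Nat.prime_dvd_prime_iff_eq hp Nat.prime_two).1 (by exact_mod_cast hc))
    rw [← ZMod.intCast_zmod_eq_zero_iff_dvd] at this
    exact_mod_cast this
  have hr' : ((a : ZMod p) + b) * (a + d) = B ^ 2 + 2 * a ^ 2 := by exact_mod_cast congrArg _ hr
  suffices H : ∃ x y : ZMod p, (a + b) * x ^ 2 - 2 * B * x * y + (a + d) * y ^ 2 = (r : ZMod p) by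
    obtain ⟨x, y, hxy⟩ := H
    obtain ⟨x, rfl⟩ := ZMod.intCast_surjective x
    obtain ⟨y, rfl⟩ := ZMod.intCast_surjective y
    refine ⟨x, y, ?_⟩
    rw [← ZMod.intCast_zmod_eq_zero_iff_dvd, tangentForm, hB]
    push_cast
    rw [hxy, sub_self]
  by_cases hA : (a : ZMod p) + b = 0
  · have hB0 : (B : ZMod p) ≠ 0 := by
      intro hB0
      rw [hA, hB0] at hr'
      have : (2 : ZMod p) * a ^ 2 = 0 := by linear_combination -hr'
      simp [h2, ha'] at this
    refine ⟨(a + d - r) / (2 * B), 1, ?_⟩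
    rw [hA]
    field_simp
    ring
  · have hodd : Fintype.card (ZMod p) % 2 = 1 := by
      rw [ZMod.card]; exact Nat.odd_iff.1 (hp.odd_of_ne_two hp2)
    obtain ⟨X, y, hXy⟩ := FiniteField.exists_root_sum_quadratic
      (f := (Polynomial.X : Polynomial (ZMod p)) ^ 2)
      (g := Polynomial.C (2 * (a : ZMod p) ^ 2) * Polynomial.X ^ 2 + Polynomial.C 0 * Polynomial.X +
        Polynomial.C (-((a + b) * (r : ZMod p)))) (by simp)
      (Polynomial.degree_quadratic (by simp [h2, ha'])) hodd
    simp only [Polynomial.eval_add, Polynomial.eval_mul, Polynomial.eval_pow, Polynomial.eval_X,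
      Polynomial.eval_C, zero_mul, add_zero] at hXy
    refine ⟨(X + B * y) / (a + b), y, ?_⟩
    rw [← mul_right_inj' hA]
    have hx : ((a : ZMod p) + b) * ((X + B * y) / (a + b)) = X + B * y := by field_simp
    generalize (X + B * y) / ((a : ZMod p) + b) = x at hx ⊢
    linear_combination hXy + y ^ 2 * hr' + ((a + b) * x - 2 * B * y + X + B * y) * hx

/-- At an odd prime, some circle of curvature `c` tangent to the given one has `c` and `c + t`
both nonzero modulo the prime. -/
theorem exists_local_neighbour (h : S a b d e) {p : ℕ} (hp : p.Prime) (hp2 : p ≠ 2) {t : ℤ}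
    (ht : (p : ℤ) ∣ 3 * a → (p : ℤ) ∣ t) :
    ∃ x y, ((p : ℤ) ∣ x → ¬ (p : ℤ) ∣ y) ∧ ¬ (p : ℤ) ∣ tangentForm a b d e x y - a ∧
      ¬ (p : ℤ) ∣ tangentForm a b d e x y - a + t := by
  have hp' := Nat.prime_iff_prime_int.1 hp
  by_cases ha : (p : ℤ) ∣ a
  · have ht := ht (ha.mul_left 3)
    suffices H : ∃ x y, ((p : ℤ) ∣ x → ¬ (p : ℤ) ∣ y) ∧ ¬ (p : ℤ) ∣ tangentForm a b d e x y by
      obtain ⟨x, y, h1, h2⟩ := H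
      refine ⟨x, y, h1, fun hc => h2 ?_, fun hc => h2 ?_⟩
      · exact (dvd_sub_left ha).1 hc
      · exact (dvd_sub_left ha).1 ((dvd_add_left ht).1 hc)
    by_contra! hcon
    have h1 := hcon 1 0 (fun h => absurd h hp'.not_dvd_one)
    have h2 := hcon 0 1 (fun _ => hp'.not_dvd_one)
    have h3 := hcon 1 1 (fun _ => hp'.not_dvd_one)
    refine hp'.not_isUnit (hS.prim h ha ?_ ?_ ?_)
    · exact (dvd_sub h1 ha).trans (dvd_of_eq (by simp [tangentForm]))
    · exact (dvd_sub h2 ha).trans (dvd_of_eq (by simp [tangentForm]))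
    · exact (dvd_sub h3 ha).trans (dvd_of_eq (by simp only [tangentForm]; ring))
  · have hpr : ∀ r x y : ℤ, ¬ (p : ℤ) ∣ r → (p : ℤ) ∣ tangentForm a b d e x y - r →
        ((p : ℤ) ∣ x → ¬ (p : ℤ) ∣ y) := by
      intro r x y hr hd hx hy
      have h0 : (p : ℤ) ∣ tangentForm a b d e x y := by
        obtain ⟨u, rfl⟩ := hx
        refine Dvd.intro ((a + b) * p * u ^ 2 - (a + b + d - e) * u * y +
          (a + d) * y * (y / p)) ?_
        have := Int.mul_ediv_cancel' hy
        simp only [tangentForm]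
        linear_combination (a + d) * y * this
      exact hr ((dvd_sub_right h0).1 hd)
    have h2 : ¬ (p : ℤ) ∣ 2 := fun hc =>
      hp2 ((Nat.prime_dvd_prime_iff_eq hp Nat.prime_two).1 (by exact_mod_cast hc))
    have h2a : ¬ (p : ℤ) ∣ 2 * a := fun hc => (hp'.dvd_or_dvd hc).elim h2 ha
    by_cases hc : (p : ℤ) ∣ t - 2 * a
    · obtain ⟨x, y, hxy⟩ := hS.exists_tangentForm_congr h hp hp2 ha (2 * a)
      refine ⟨x, y, hpr _ x y h2a hxy, fun hd => ha ?_, fun hd => ?_⟩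
      · exact (dvd_sub hd hxy).trans (dvd_of_eq (by ring))
      · have h3 : (p : ℤ) ∣ 3 * a := by
          exact (dvd_sub (dvd_sub hd hxy) hc).trans (dvd_of_eq (by ring))
        exact h2a ((dvd_sub (ht h3) hc).trans (dvd_of_eq (by ring)))
    · obtain ⟨x, y, hxy⟩ := hS.exists_tangentForm_congr h hp hp2 ha (-a)
      refine ⟨x, y, hpr _ x y (by rwa [dvd_neg]) hxy, fun hd => h2a ?_, fun hd => hc ?_⟩
      · exact (dvd_sub hxy hd).trans (dvd_of_eq (by ring))
      · exact (dvd_sub hd hxy).trans (dvd_of_eq (by ring))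

/-- If `a ≡ t` modulo `8` is even with an odd neighbour, and `t ≡ 0` at `3` and at the odd
primes dividing `a`, then `t` is congruent to curvatures modulo every integer.  They are found
two steps away from the given circle: the first step reaches a circle whose curvature `c` makes
`c (c + t)` a unit at all odd primes in question, so that the form at this circle represents
`c + t` there; at the prime `2` it represents `c + a`, which is `c + t` times a square. -/
theorem exists_congr (h : S a b d e) (ha : Even a) (hb : Odd b) {t : ℤ}
    (ht8 : 8 ∣ a - t) (ht : ∀ p : ℕ, p.Prime → p ≠ 2 → (p : ℤ) ∣ 3 * a → (p : ℤ) ∣ t)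
    {m : ℕ} (hm : m ≠ 0) : ∃ c b' d' e', S c b' d' e' ∧ (m : ℤ) ∣ c - t := by
  have hex : ∀ p : ℕ, ∃ x y : ℤ, p.Prime → p ≠ 2 → ((p : ℤ) ∣ x → ¬ (p : ℤ) ∣ y) ∧
      ¬ (p : ℤ) ∣ tangentForm a b d e x y - a ∧ ¬ (p : ℤ) ∣ tangentForm a b d e x y - a + t := by
    intro p
    by_cases hp : p.Prime ∧ p ≠ 2
    · obtain ⟨x, y, hxy⟩ := hS.exists_local_neighbour h hp.1 hp.2 (ht p hp.1 hp.2)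
      exact ⟨x, y, fun _ _ => hxy⟩
    · exact ⟨0, 0, fun h1 h2 => absurd ⟨h1, h2⟩ hp⟩
  choose u v huv using hex
  obtain ⟨x, y, hxy, hcong⟩ := exists_isCoprime_congr (2 * m) (fun _ => 1) (fun _ _ => le_rfl)
    (fun p => if p = 2 then 1 else u p) (fun p => if p = 2 then 0 else v p) (by
      intro p hp
      split_ifs with hp2
      · subst hp2; norm_num
      · exact (huv p (Nat.prime_of_mem_primeFactors hp) hp2).1)
  simp only [pow_one] at hcong
  obtain ⟨d₁, e₁, h1⟩ := hS.exists_of_isCoprime h hxy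
  have hQodd : Odd (tangentForm a b d e x y) := by
    have h2 := hcong 2 (Nat.mem_primeFactors.2 ⟨Nat.prime_two, Dvd.intro _ rfl, by omega⟩)
    simp only [if_true] at h2
    have h3 := tangentForm_sub_dvd (a := a) (b := b) (d := d) (e := e) h2.1 h2.2
    have h4 : tangentForm a b d e 1 0 = a + b := by simp [tangentForm]
    rw [h4] at h3
    have := ha.add_odd hb
    rw [Int.odd_iff] at this ⊢
    push_cast at h3
    omega
  have hc : ∀ p ∈ m.primeFactors, p ≠ 2 → ¬ (p : ℤ) ∣ tangentForm a b d e x y - a ∧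
      ¬ (p : ℤ) ∣ tangentForm a b d e x y - a + t := by
    intro p hp hp2
    have hpp := Nat.prime_of_mem_primeFactors hp
    have h2 := hcong p (Nat.mem_primeFactors.2
      ⟨hpp, (Nat.dvd_of_mem_primeFactors hp).mul_left 2, by omega⟩)
    simp only [if_neg hp2] at h2
    have h3 := tangentForm_sub_dvd (a := a) (b := b) (d := d) (e := e) h2.1 h2.2
    obtain ⟨-, h4, h5⟩ := huv p hpp hp2
    refine ⟨fun hd => h4 ?_, fun hd => h5 ?_⟩
    · exact (dvd_sub hd h3).trans (dvd_of_eq (by ring))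
    · exact (dvd_sub hd h3).trans (dvd_of_eq (by ring))
  have h2 := hS.cross h1
  generalize tangentForm a b d e x y = ρ at *
  obtain ⟨c, rfl⟩ : ∃ c, ρ = c + a := ⟨ρ - a, by ring⟩
  simp only [add_sub_cancel_right] at h1 h2 hc
  generalize c + d₁ - a = d₂ at h2
  generalize c + e₁ - a = e₂ at h2
  have hloc : ∀ p : ℕ, ∃ z w : ℤ, p ∈ m.primeFactors →
      (p : ℤ) ^ m.factorization p ∣ tangentForm c a d₂ e₂ z w - (c + t) := by
    intro p
    by_cases hp : p ∈ m.primeFactors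
    · have hpp := Nat.prime_of_mem_primeFactors hp
      have hsc : ∀ l z w, tangentForm c a d₂ e₂ (l * z) (l * w) =
          l ^ 2 * tangentForm c a d₂ e₂ z w := by
        intro l z w; simp only [tangentForm]; ring
      by_cases hp2 : p = 2
      · subst hp2
        obtain ⟨l, hl⟩ := exists_sq_mul_congr_two (r := c + a) (s := c + t) hQodd
          (ht8.trans (dvd_of_eq (by ring))) (m.factorization 2)
        refine ⟨l * 1, l * 0, fun _ => ?_⟩
        rw [hsc]
        have h1 : tangentForm c a d₂ e₂ 1 0 = c + a := by simp [tangentForm]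
        rwa [h1]
      · obtain ⟨h3, h4⟩ := hc p hp hp2
        obtain ⟨z, w, hzw⟩ := hS.exists_tangentForm_congr h2 hpp hp2 h3 (c + t)
        obtain ⟨l, hl⟩ := exists_sq_mul_congr_odd hpp hp2
          (fun hd => h4 ((dvd_sub_right hd).1 hzw)) hzw (m.factorization p)
        exact ⟨l * z, l * w, fun _ => by rwa [hsc]⟩
    · exact ⟨0, 0, fun h => absurd h hp⟩
  choose z w hzw using hloc
  have hfac : ∀ p ∈ m.primeFactors, 1 ≤ m.factorization p := fun p hp =>
    Nat.one_le_iff_ne_zero.2 (Finsupp.mem_support_iff.1 (by simpa using hp))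
  obtain ⟨Z, W, hZW, hcong'⟩ := exists_isCoprime_congr m m.factorization hfac z w (by
    intro p hp hz hw
    have h3 : (p : ℤ) ∣ tangentForm c a d₂ e₂ (z p) (w p) := by
      have := tangentForm_sub_dvd (a := c) (b := a) (d := d₂) (e := e₂) (p := (p : ℤ))
        (x := z p) (y := w p) (x' := 0) (y' := 0) (by simpa using hz) (by simpa using hw)
      simpa [tangentForm] using this
    have h4 : (p : ℤ) ∣ c + t := (dvd_sub_right h3).1
      ((dvd_pow_self _ (by have := hfac p hp; omega)).trans (hzw p hp))
    by_cases hp2 : p = 2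
    · subst hp2
      rw [Int.odd_iff] at hQodd
      push_cast at h4
      omega
    · exact (hc p hp hp2).2 h4)
  obtain ⟨d₃, e₃, h3⟩ := hS.exists_of_isCoprime h2 hZW
  refine ⟨_, _, _, _, hS.cross h3, dvd_of_forall_factorization hm fun p hp => ?_⟩
  have h4 := tangentForm_sub_dvd (a := c) (b := a) (d := d₂) (e := e₂) (hcong' p hp).1
    (hcong' p hp).2
  exact (dvd_add h4 (hzw p hp)).trans (dvd_of_eq (by ring))

end OctupleSystem

/-! ### The inversive form and cubes of circles -/

/-- The inversive form as a bilinear form of signature `(3, 1)` on `ℝ⁴`, in the coordinates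
`(cocurv, curv, h₁, h₂)`. -/
noncomputable def inversiveForm : LinearMap.BilinForm ℝ (Fin 4 → ℝ) :=
  LinearMap.mk₂ ℝ (fun x y => x 2 * y 2 + x 3 * y 3 - (x 1 * y 0 + x 0 * y 1) / 2)
    (fun _ _ _ => by simp only [Pi.add_apply]; ring)
    (fun _ _ _ => by simp only [Pi.smul_apply, smul_eq_mul]; ring)
    (fun _ _ _ => by simp only [Pi.add_apply]; ring)
    (fun _ _ _ => by simp only [Pi.smul_apply, smul_eq_mul]; ring)

theorem inversiveForm_apply (x y : Fin 4 → ℝ) :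
    inversiveForm x y = x 2 * y 2 + x 3 * y 3 - (x 1 * y 0 + x 0 * y 1) / 2 := rfl

theorem inversiveForm_comm (x y : Fin 4 → ℝ) : inversiveForm x y = inversiveForm y x := by
  simp only [inversiveForm_apply]; ring

/-- The orthogonal complement of a hyperbolic plane is positive definite. -/
theorem eq_zero_of_null_of_orthogonal {f g m : Fin 4 → ℝ} (hf : inversiveForm f f = 0)
    (hg : inversiveForm g g = 0) (hfg : inversiveForm f g ≠ 0) (hm : inversiveForm m m = 0)
    (hmf : inversiveForm m f = 0) (hmg : inversiveForm m g = 0) : m = 0 := by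
  -- `T` is a timelike vector orthogonal to `m`
  obtain ⟨T, hT⟩ : ∃ T, T = f - inversiveForm f g • g := ⟨_, rfl⟩
  have h1 : inversiveForm T T < 0 := by
    have : inversiveForm T T = -2 * inversiveForm f g ^ 2 := by
      rw [hT]
      simp only [map_sub, map_smul, LinearMap.sub_apply, LinearMap.smul_apply, smul_eq_mul,
        inversiveForm_comm g f, hf, hg]
      ring
    rw [this]
    have := pow_pos (abs_pos.2 hfg) 2
    rw [sq_abs] at this
    linarith
  have h2 : inversiveForm m T = 0 := by
    rw [hT]; simp [hmf, hmg]
  clear hT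
  rw [inversiveForm_apply] at h1 h2 hm
  have h3 : (m 2 * T 2 + m 3 * T 3) ^ 2 ≤ (m 2 ^ 2 + m 3 ^ 2) * (T 2 ^ 2 + T 3 ^ 2) := by
    nlinarith [sq_nonneg (m 2 * T 3 - m 3 * T 2)]
  have h4 : (m 2 * T 2 + m 3 * T 3) ^ 2 ≥ (m 1 * m 0) * (T 1 * T 0) := by
    have : m 2 * T 2 + m 3 * T 3 = (m 1 * T 0 + m 0 * T 1) / 2 := by linarith
    rw [this]
    nlinarith [sq_nonneg (m 1 * T 0 - m 0 * T 1)]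
  have hm' : m 2 ^ 2 + m 3 ^ 2 = m 1 * m 0 := by linarith
  have h5 : m 2 ^ 2 + m 3 ^ 2 ≤ 0 := by
    rw [← hm'] at h4
    by_contra! hpos
    have : T 2 ^ 2 + T 3 ^ 2 < T 1 * T 0 := by linarith
    nlinarith [mul_lt_mul_of_pos_left this hpos]
  have m2 : m 2 = 0 := by nlinarith [sq_nonneg (m 2), sq_nonneg (m 3)]
  have m3 : m 3 = 0 := by nlinarith [sq_nonneg (m 2), sq_nonneg (m 3)]
  have hT10 : 0 < T 1 * T 0 := by nlinarith [sq_nonneg (T 2), sq_nonneg (T 3)]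
  rw [m2, m3] at hm' h2
  have m10 : m 1 * m 0 = 0 := by linarith
  have hT1 : T 1 ≠ 0 := left_ne_zero_of_mul hT10.ne'
  have hT0 : T 0 ≠ 0 := right_ne_zero_of_mul hT10.ne'
  have hs : m 1 * T 0 + m 0 * T 1 = 0 := by linarith
  have hm01 : m 0 = 0 ∧ m 1 = 0 := by
    rcases mul_eq_zero.1 m10 with h | h
    · rw [h] at hs
      simp only [zero_mul, zero_add, mul_eq_zero, hT1, or_false] at hs
      exact ⟨hs, h⟩
    · rw [h] at hs
      simp only [zero_mul, add_zero, mul_eq_zero, hT0, or_false] at hs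
      exact ⟨h, hs⟩
  ext i
  fin_cases i
  · exact hm01.1
  · exact hm01.2
  · exact m2
  · exact m3

/-- A circle and three mutually tangent circles orthogonal to it span `ℝ⁴`. -/
theorem eq_zero_of_orthogonal_frame {v F G H x : Fin 4 → ℝ} (hv : inversiveForm v v = 1)
    (hF : inversiveForm F F = 1) (hG : inversiveForm G G = 1) (hH : inversiveForm H H = 1)
    (hvF : inversiveForm v F = 0) (hvG : inversiveForm v G = 0) (hvH : inversiveForm v H = 0)
    (hFG : inversiveForm F G = -1) (hFH : inversiveForm F H = -1) (hGH : inversiveForm G H = -1)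
    (xv : inversiveForm v x = 0) (xF : inversiveForm F x = 0) (xG : inversiveForm G x = 0)
    (xH : inversiveForm H x = 0) : x = 0 := by
  let P : Matrix (Fin 4) (Fin 4) ℝ := Matrix.of ![v, F, G, H]
  let J : Matrix (Fin 4) (Fin 4) ℝ :=
    !![0, -1/2, 0, 0; -1/2, 0, 0, 0; 0, 0, 1, 0; 0, 0, 0, 1]
  have hJ : ∀ y z : Fin 4 → ℝ, y ⬝ᵥ (J.mulVec z) = inversiveForm y z := by
    intro y z
    simp [J, Matrix.mulVec, dotProduct, Fin.sum_univ_four, inversiveForm_apply]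
    ring
  have P0 : P 0 = v := rfl
  have P1 : P 1 = F := rfl
  have P2 : P 2 = G := rfl
  have P3 : P 3 = H := rfl
  have hgram : P * (J * P.transpose) = !![1, 0, 0, 0; 0, 1, -1, -1; 0, -1, 1, -1; 0, -1, -1, 1] := by
    have : ∀ i j, (P * (J * P.transpose)) i j = inversiveForm (P i) (P j) := fun i j => hJ _ _
    ext i j
    rw [this]
    fin_cases i <;> fin_cases j <;>
      simp [P0, P1, P2, P3, hv, hF, hG, hH, hvF, hvG, hvH, hFG, hFH, hGH, inversiveForm_comm F v,
        inversiveForm_comm G v, inversiveForm_comm H v, inversiveForm_comm G F,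
        inversiveForm_comm H F, inversiveForm_comm H G]
  have hdet : (P * (J * P.transpose)).det ≠ 0 := by
    rw [hgram]
    simp [Matrix.det_succ_row_zero, Fin.sum_univ_succ, Fin.succAbove]
  have hPJ : (P * J).det ≠ 0 := by
    rw [← Matrix.mul_assoc, Matrix.det_mul] at hdet
    exact left_ne_zero_of_mul hdet
  refine Matrix.eq_zero_of_mulVec_eq_zero hPJ ?_
  rw [← Matrix.mulVec_mulVec]
  ext i
  change P i ⬝ᵥ (J.mulVec x) = 0
  rw [hJ]
  fin_cases i
  · exact xv
  · exact xF
  · exact xG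
  · exact xH

theorem flip_apply_self (v : Vertex) (i : Fin 3) : flip v i i = !(v i) := by simp [flip]

theorem flip_apply_of_ne (v : Vertex) {i j : Fin 3} (h : j ≠ i) : flip v i j = v j := by
  simp [flip, h]

theorem flip_flip (v : Vertex) (i : Fin 3) : flip (flip v i) i = v := by
  simp [flip]

theorem flip_flip_comm (v : Vertex) {i j : Fin 3} (h : i ≠ j) :
    flip (flip v i) j = flip (flip v j) i := by
  simp only [flip, Function.update_of_ne h.symm, Function.update_of_ne h]
  exact Function.update_comm h _ _ _

/-- Base and dual vectors of a cubic configuration, where the dual circles are oriented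
coherently, that is, so that adjacent ones have product `-1`. -/
structure IsCubeFrame (b : Vertex → Fin 4 → ℝ) (G : Face → Fin 4 → ℝ) : Prop where
  base_self : ∀ v, inversiveForm (b v) (b v) = 1
  base_flip : ∀ v i, inversiveForm (b v) (b (flip v i)) = -1
  dual_self : ∀ F, inversiveForm (G F) (G F) = 1
  dual_adj : ∀ F F' : Face, F.1 ≠ F'.1 → inversiveForm (G F) (G F') = -1
  dual_opp : ∀ i s, inversiveForm (G (i, s)) (G (i, !s)) ≠ 1
  incident : ∀ v i s, v i = s → inversiveForm (b v) (G (i, s)) = 0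
  not_incident : ∀ v i s, v i ≠ s → inversiveForm (b v) (G (i, s)) ≠ 0

namespace IsCubeFrame

variable {b : Vertex → Fin 4 → ℝ} {G : Face → Fin 4 → ℝ} (h : IsCubeFrame b G)

/-- The point of tangency of two adjacent base circles is also that of two dual circles, so the
sum of the former vectors is a multiple of the sum of the latter ones, this being the factor. -/
noncomputable def scale (b : Vertex → Fin 4 → ℝ) (G : Face → Fin 4 → ℝ) (v : Vertex)
    (i : Fin 3) : ℝ :=
  -inversiveForm (b (flip v i)) (G (i, v i)) / 2

include h

theorem eq_zero {v : Vertex} {i j k : Fin 3} (hij : i ≠ j) (hik : i ≠ k) (hjk : j ≠ k)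
    {x : Fin 4 → ℝ} (xv : inversiveForm (b v) x = 0) (xi : inversiveForm (G (i, v i)) x = 0)
    (xj : inversiveForm (G (j, v j)) x = 0) (xk : inversiveForm (G (k, v k)) x = 0) : x = 0 :=
  eq_zero_of_orthogonal_frame (h.base_self v) (h.dual_self _) (h.dual_self _) (h.dual_self _)
    (h.incident v i _ rfl) (h.incident v j _ rfl) (h.incident v k _ rfl) (h.dual_adj _ _ hij)
    (h.dual_adj _ _ hik) (h.dual_adj _ _ hjk) xv xi xj xk

theorem base_add_base_flip (v : Vertex) {i j k : Fin 3} (hij : i ≠ j) (hik : i ≠ k)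
    (hjk : j ≠ k) :
    b v + b (flip v i) = scale b G v i • (G (j, v j) + G (k, v k)) := by
  rw [← sub_eq_zero]
  have hc := inversiveForm_comm
  have h1 := h.incident v i _ rfl
  have h2 := h.incident v j _ rfl
  have h3 := h.incident v k _ rfl
  have h4 := h.incident (flip v i) j (v j) (flip_apply_of_ne v hij.symm)
  have h5 := h.incident (flip v i) k (v k) (flip_apply_of_ne v hik.symm)
  have g1 := h.dual_adj (i, v i) (j, v j) hij
  have g2 := h.dual_adj (i, v i) (k, v k) hik
  have g3 := h.dual_adj (j, v j) (k, v k) hjk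
  refine h.eq_zero (v := v) hij hik hjk ?_ ?_ ?_ ?_ <;>
    simp only [map_add, map_sub, map_smul, smul_eq_mul]
  · rw [h.base_self, h.base_flip, h2, h3]; ring
  · rw [hc _ (b v), h1, g1, g2, hc _ (b (flip v i)), scale]; ring
  · rw [hc _ (b v), h2, h.dual_self, g3, hc _ (b (flip v i)), h4]; ring
  · rw [hc _ (b v), h3, h.dual_self, hc (G (k, v k)) (G (j, v j)), g3, hc _ (b (flip v i)), h5]
    ring

theorem scale_ne_zero (v : Vertex) (i : Fin 3) : scale b G v i ≠ 0 := by
  have := h.not_incident (flip v i) i (v i) (by rw [flip_apply_self]; simp)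
  simpa [scale] using this

/-- Summing the relation for the four sides of a face with alternating signs shows that
opposite sides have the same factor. -/
theorem scale_flip_and (v : Vertex) {i j k : Fin 3} (hij : i ≠ j) (hik : i ≠ k)
    (hjk : j ≠ k) :
    scale b G (flip v i) j = scale b G v j ∧
      scale b G v j * (1 - inversiveForm (G (i, v i)) (G (i, !(v i)))) = 4 * scale b G v i := by
  have e1 := h.base_add_base_flip v hij hik hjk
  have e2 := h.base_add_base_flip (flip v i) hij.symm hjk hik
  have e3 := h.base_add_base_flip (flip v j) hij hik hjk
  have e4 := h.base_add_base_flip v hij.symm hjk hik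
  rw [flip_apply_self, flip_apply_of_ne _ hik.symm, flip_flip_comm v hij] at e2
  rw [flip_apply_self, flip_apply_of_ne _ hjk.symm] at e3
  set l₀ := scale b G v i
  set l₁ := scale b G v j
  set m₁ := scale b G (flip v i) j
  set n₀ := scale b G (flip v j) i
  have key : l₀ • (G (j, v j) + G (k, v k)) + n₀ • (G (j, !(v j)) + G (k, v k)) =
      m₁ • (G (i, !(v i)) + G (k, v k)) + l₁ • (G (i, v i) + G (k, v k)) := by
    rw [← e1, ← e2, ← e3, ← e4]; abel
  have hc := inversiveForm_comm
  have gij : ∀ s t, inversiveForm (G (i, s)) (G (j, t)) = -1 := fun s t => h.dual_adj _ _ hij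
  have gik : ∀ s t, inversiveForm (G (i, s)) (G (k, t)) = -1 := fun s t => h.dual_adj _ _ hik
  have gji : ∀ s t, inversiveForm (G (j, s)) (G (i, t)) = -1 := fun s t => h.dual_adj _ _ hij.symm
  have gjk : ∀ s t, inversiveForm (G (j, s)) (G (k, t)) = -1 := fun s t => h.dual_adj _ _ hjk
  have k1 := congrArg (inversiveForm (G (i, v i))) key
  have k2 := congrArg (inversiveForm (G (i, !(v i)))) key
  have k3 := congrArg (inversiveForm (G (j, v j))) key
  have k4 := congrArg (inversiveForm (G (j, !(v j)))) key
  simp only [map_add, map_smul, smul_eq_mul, gij, gik, gji, gjk, h.dual_self] at k1 k2 k3 k4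
  rw [hc (G (i, !(v i)))] at k2
  rw [hc (G (j, !(v j)))] at k4
  have hi := h.dual_opp i (v i)
  have hj := h.dual_opp j (v j)
  set y := inversiveForm (G (i, v i)) (G (i, !(v i)))
  set x := inversiveForm (G (j, v j)) (G (j, !(v j)))
  have hm : m₁ = l₁ := by
    have : (m₁ - l₁) * (1 - y) = 0 := by linear_combination k1 - k2
    rcases mul_eq_zero.1 this with h0 | h0
    · linarith
    · exact absurd (by linarith) hi
  have hn : n₀ = l₀ := by
    have : (n₀ - l₀) * (1 - x) = 0 := by linear_combination k4 - k3
    rcases mul_eq_zero.1 this with h0 | h0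
    · linarith
    · exact absurd (by linarith) hj
  refine ⟨hm, ?_⟩
  rw [hn] at k2
  linear_combination k2

theorem scale_eq (v : Vertex) {i j : Fin 3} (hij : i ≠ j) : scale b G v i = scale b G v j := by
  obtain ⟨k, hki, hkj⟩ : ∃ k : Fin 3, k ≠ i ∧ k ≠ j := by
    revert i j; decide
  have h1 := (h.scale_flip_and v hki hkj hij).2
  have h2 := (h.scale_flip_and v hkj hki hij.symm).2
  have h3 := h.dual_opp k (v k)
  have : (scale b G v i - scale b G v j) *
      (1 - inversiveForm (G (k, v k)) (G (k, !(v k)))) = 0 := by linear_combination h1 - h2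
  rcases mul_eq_zero.1 this with h0 | h0
  · linarith
  · exact absurd (by linarith) h3

theorem dual_opp_eq (v : Vertex) (i : Fin 3) :
    inversiveForm (G (i, v i)) (G (i, !(v i))) = -3 := by
  obtain ⟨j, k, hij, hik, hjk⟩ : ∃ j k : Fin 3, i ≠ j ∧ i ≠ k ∧ j ≠ k := by
    revert i; decide
  have h1 := (h.scale_flip_and v hij hik hjk).2
  rw [h.scale_eq v hij] at h1
  have := mul_left_cancel₀ (h.scale_ne_zero v j) (h1.trans (mul_comm _ _))
  linarith

theorem dual_opp_expansion (v : Vertex) {i j k : Fin 3} (hij : i ≠ j) (hik : i ≠ k)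
    (hjk : j ≠ k) :
    G (i, !(v i)) = G (i, v i) + (2 : ℝ) • G (j, v j) + (2 : ℝ) • G (k, v k) -
      (2 * scale b G v i) • b v := by
  rw [← sub_eq_zero]
  have hc := inversiveForm_comm
  have h1 := h.incident v i _ rfl
  have h2 := h.incident v j _ rfl
  have h3 := h.incident v k _ rfl
  have gij : ∀ s t, inversiveForm (G (i, s)) (G (j, t)) = -1 := fun s t => h.dual_adj _ _ hij
  have gik : ∀ s t, inversiveForm (G (i, s)) (G (k, t)) = -1 := fun s t => h.dual_adj _ _ hik
  have gji : ∀ s t, inversiveForm (G (j, s)) (G (i, t)) = -1 := fun s t => h.dual_adj _ _ hij.symm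
  have gki : ∀ s t, inversiveForm (G (k, s)) (G (i, t)) = -1 := fun s t => h.dual_adj _ _ hik.symm
  have gjk : ∀ s t, inversiveForm (G (j, s)) (G (k, t)) = -1 := fun s t => h.dual_adj _ _ hjk
  have gkj : ∀ s t, inversiveForm (G (k, s)) (G (j, t)) = -1 := fun s t => h.dual_adj _ _ hjk.symm
  have hv : inversiveForm (b v) (G (i, !(v i))) = -2 * scale b G v i := by
    have e1 := congrArg (inversiveForm (G (i, !(v i)))) (h.base_add_base_flip v hij hik hjk)
    have e2 := h.incident (flip v i) i _ rfl
    rw [flip_apply_self] at e2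
    simp only [map_add, map_smul, smul_eq_mul, gij, gik] at e1
    rw [hc _ (b (flip v i)), e2, hc _ (b v)] at e1
    linear_combination e1
  refine h.eq_zero (v := v) hij hik hjk ?_ ?_ ?_ ?_ <;>
    simp only [map_add, map_sub, map_smul, smul_eq_mul, gij, gik, gji, gki, gjk, gkj, h.dual_self,
      h.base_self, hv, h1, h2, h3, hc _ (b v), h.dual_opp_eq] <;> ring

theorem scale_sq (v : Vertex) (i : Fin 3) : scale b G v i ^ 2 = 2 := by
  obtain ⟨j, k, hij, hik, hjk⟩ : ∃ j k : Fin 3, i ≠ j ∧ i ≠ k ∧ j ≠ k := by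
    revert i; decide
  have e := congrArg (fun x => inversiveForm x x) (h.dual_opp_expansion v hij hik hjk)
  have hc := inversiveForm_comm
  have h1 := h.incident v i _ rfl
  have h2 := h.incident v j _ rfl
  have h3 := h.incident v k _ rfl
  have gij : ∀ s t, inversiveForm (G (i, s)) (G (j, t)) = -1 := fun s t => h.dual_adj _ _ hij
  have gik : ∀ s t, inversiveForm (G (i, s)) (G (k, t)) = -1 := fun s t => h.dual_adj _ _ hik
  have gji : ∀ s t, inversiveForm (G (j, s)) (G (i, t)) = -1 := fun s t => h.dual_adj _ _ hij.symm
  have gki : ∀ s t, inversiveForm (G (k, s)) (G (i, t)) = -1 := fun s t => h.dual_adj _ _ hik.symm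
  have gjk : ∀ s t, inversiveForm (G (j, s)) (G (k, t)) = -1 := fun s t => h.dual_adj _ _ hjk
  have gkj : ∀ s t, inversiveForm (G (k, s)) (G (j, t)) = -1 := fun s t => h.dual_adj _ _ hjk.symm
  simp only [map_add, map_sub, map_smul, smul_eq_mul, LinearMap.add_apply, LinearMap.sub_apply,
    LinearMap.smul_apply, gij, gik, gji, gki, gjk, gkj, h.dual_self,
    h.base_self, h1, h2, h3, hc _ (b v)] at e
  linarith

theorem base_flip_eq (v : Vertex) {i j k : Fin 3} (hij : i ≠ j) (hik : i ≠ k)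
    (hjk : j ≠ k) :
    b (flip v i) = scale b G v 0 • (G (j, v j) + G (k, v k)) - b v := by
  have hs : scale b G v 0 = scale b G v i := by
    by_cases h0 : 0 = i
    · rw [h0]
    · exact h.scale_eq v h0
  rw [hs, ← h.base_add_base_flip v hij hik hjk]
  abel

/-- The vectors of the base circles form an affine cube. -/
theorem base_flip_flip (v : Vertex) {i j : Fin 3} (hij : i ≠ j) :
    b (flip (flip v i) j) = b (flip v i) + b (flip v j) - b v := by
  obtain ⟨k, hki, hkj⟩ : ∃ k : Fin 3, k ≠ i ∧ k ≠ j := by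
    revert i j; decide
  have e2 := h.base_add_base_flip (flip v i) hij.symm hkj.symm hki.symm
  rw [flip_apply_self, flip_apply_of_ne _ hki, (h.scale_flip_and v hij hki.symm hkj.symm).1,
    h.dual_opp_expansion v hij hki.symm hkj.symm] at e2
  have e1 := h.base_add_base_flip v hij hki.symm hkj.symm
  have e4 := h.base_add_base_flip v hij.symm hkj.symm hki.symm
  rw [h.scale_eq v hij] at e1 e2
  have hsq := h.scale_sq v j
  set l := scale b G v j
  have h1 : b (flip v i) = l • (G (j, v j) + G (k, v k)) - b v := by rw [← e1]; abel
  have h2 : b (flip v j) = l • (G (i, v i) + G (k, v k)) - b v := by rw [← e4]; abel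
  have h3 : b (flip (flip v i) j) = l • (G (i, v i) + (2 : ℝ) • G (j, v j) + (2 : ℝ) • G (k, v k) -
      (2 * l) • b v + G (k, v k)) - b (flip v i) := by rw [← e2]; abel
  rw [h3, h1, h2]
  ext t
  simp only [Pi.sub_apply, Pi.add_apply, Pi.smul_apply, smul_eq_mul]
  linear_combination (-2 * b v t) * hsq

/-- The reflection across a dual circle on the remaining base vectors. -/
theorem reflect_base (v : Vertex) {i j k : Fin 3} (hij : i ≠ j) (hik : i ≠ k) (hjk : j ≠ k) :
    b (flip v i) - (2 * inversiveForm (b (flip v i)) (G (i, v i))) • G (i, v i) =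
      (2 : ℝ) • b v + (2 : ℝ) • b (flip v j) + (2 : ℝ) • b (flip v k) - b (flip v i) := by
  have hs : inversiveForm (b (flip v i)) (G (i, v i)) = -2 * scale b G v 0 := by
    have : scale b G v 0 = scale b G v i := by
      by_cases h0 : 0 = i
      · rw [h0]
      · exact h.scale_eq v h0
    rw [this, scale]; ring
  rw [hs, h.base_flip_eq v hij hik hjk, h.base_flip_eq v hij.symm hjk hik,
    h.base_flip_eq v hik.symm hjk.symm hij]
  ext t
  simp only [Pi.sub_apply, Pi.add_apply, Pi.smul_apply, smul_eq_mul]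
  ring

/-- The quadratic relation between the values of the linear form defined by a null vector. -/
theorem null_relation {N : Fin 4 → ℝ} (hN : inversiveForm N N = 0) (v : Vertex) :
    (inversiveForm N (b v) + inversiveForm N (b (flip v 0)) + inversiveForm N (b (flip v 1)) -
        inversiveForm N (b (flip v 2))) ^ 2 -
      4 * (inversiveForm N (b v) + inversiveForm N (b (flip v 0))) *
        (inversiveForm N (b v) + inversiveForm N (b (flip v 1))) =
      -8 * inversiveForm N (b v) ^ 2 := by
  have h01 : (0 : Fin 3) ≠ 1 := by decide
  have h02 : (0 : Fin 3) ≠ 2 := by decide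
  have h12 : (1 : Fin 3) ≠ 2 := by decide
  have hc := inversiveForm_comm
  have h1 := h.incident v 0 _ rfl
  have h2 := h.incident v 1 _ rfl
  have h3 := h.incident v 2 _ rfl
  have g01 := h.dual_adj (0, v 0) (1, v 1) h01
  have g02 := h.dual_adj (0, v 0) (2, v 2) h02
  have g12 := h.dual_adj (1, v 1) (2, v 2) h12
  have g10 := h.dual_adj (1, v 1) (0, v 0) h01.symm
  have g20 := h.dual_adj (2, v 2) (0, v 0) h02.symm
  have g21 := h.dual_adj (2, v 2) (1, v 1) h12.symm
  have hsq := h.scale_sq v 0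
  have hq : inversiveForm N (G (0, v 0)) * inversiveForm N (G (1, v 1)) +
      inversiveForm N (G (0, v 0)) * inversiveForm N (G (2, v 2)) +
      inversiveForm N (G (1, v 1)) * inversiveForm N (G (2, v 2)) = inversiveForm N (b v) ^ 2 := by
    have hx : N - (inversiveForm N (b v) • b v -
        ((inversiveForm N (G (1, v 1)) + inversiveForm N (G (2, v 2))) / 2) • G (0, v 0) -
        ((inversiveForm N (G (0, v 0)) + inversiveForm N (G (2, v 2))) / 2) • G (1, v 1) -
        ((inversiveForm N (G (0, v 0)) + inversiveForm N (G (1, v 1))) / 2) • G (2, v 2)) = 0 := by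
      refine h.eq_zero (v := v) h01 h02 h12 ?_ ?_ ?_ ?_ <;>
        simp only [map_sub, map_smul, smul_eq_mul, hc (b v) N, hc (G _) N, hc (G _) (b v), h1, h2, h3, g01, g02, g12,
          g10, g20, g21, h.dual_self, h.base_self] <;> ring
    have := congrArg (inversiveForm N) hx
    simp only [map_sub, map_smul, smul_eq_mul, hN, map_zero] at this
    linear_combination this
  rw [h.base_flip_eq v h01 h02 h12, h.base_flip_eq v h01.symm h12 h02,
    h.base_flip_eq v h02.symm h12.symm h01]
  simp only [map_sub, map_add, map_smul, smul_eq_mul]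
  set q₀ := inversiveForm N (G (0, v 0))
  set q₁ := inversiveForm N (G (1, v 1))
  set q₂ := inversiveForm N (G (2, v 2))
  linear_combination (-8) * hq - 4 * (q₀ * q₁ + q₀ * q₂ + q₁ * q₂) * hsq

end IsCubeFrame

/-! ### The curvatures of a cubic packing -/

namespace OrientedCircle

/-- The vector of inversive coordinates of an oriented circle. -/
noncomputable def toVec (C : OrientedCircle) : Fin 4 → ℝ := ![C.cocurv, C.curv, C.h₁, C.h₂]

theorem form_eq (C D : OrientedCircle) : form C D = inversiveForm C.toVec D.toVec := rfl

theorem inversiveForm_toVec_self (C : OrientedCircle) : inversiveForm C.toVec C.toVec = 1 := by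
  have h := C.norm_eq
  rw [← form_eq, form]
  linarith

end OrientedCircle

open OrientedCircle

/-- The reflection in the hyperplane orthogonal to a unit vector. -/
noncomputable def vecReflect (D : Fin 4 → ℝ) : (Fin 4 → ℝ) →ₗ[ℝ] (Fin 4 → ℝ) :=
  LinearMap.id - (2 : ℝ) • (LinearMap.toSpanSingleton ℝ _ D ∘ₗ inversiveForm.flip D)

theorem vecReflect_apply (D x : Fin 4 → ℝ) :
    vecReflect D x = x - (2 * inversiveForm x D) • D := by
  simp [vecReflect, smul_smul]

theorem toVec_reflect (D C : OrientedCircle) :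
    (reflect D C).toVec = vecReflect D.toVec C.toVec := by
  rw [vecReflect_apply, ← form_eq]
  ext i
  fin_cases i <;> simp [toVec, reflect]

namespace CubicConfiguration

variable (K : CubicConfiguration)

/-- Three faces at a vertex do not pass through a common point of tangency: if they did, a
neighbour orthogonal to two of them would be orthogonal to all three. -/
theorem dual_triangle (v : Vertex) :
    (K.dual (0, v 0)).form (K.dual (1, v 1)) * (K.dual (1, v 1)).form (K.dual (2, v 2)) *
      (K.dual (0, v 0)).form (K.dual (2, v 2)) = -1 := by
  have hsq : ∀ F F', FaceAdj F F' → (K.dual F).form (K.dual F') = 1 ∨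
      (K.dual F).form (K.dual F') = -1 := fun F F' h => eq_or_eq_neg_of_abs_eq (K.dual_tangent F F' h)
  have h01 := hsq (0, v 0) (1, v 1) (by simp [FaceAdj])
  have h12 := hsq (1, v 1) (2, v 2) (by simp [FaceAdj])
  have h02 := hsq (0, v 0) (2, v 2) (by simp [FaceAdj])
  have f0 := K.orthogonal v (0, v 0) rfl
  have f1 := K.orthogonal v (1, v 1) rfl
  have f2 := K.orthogonal v (2, v 2) rfl
  have inc : ∀ i j, j ≠ i → (K.base (flip v i)).form (K.dual (j, v j)) = 0 := fun i j h =>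
    K.orthogonal _ _ (flip_apply_of_ne v h)
  have ninc : ∀ i, (K.base (flip v i)).form (K.dual (i, v i)) ≠ 0 := fun i h0 => by
    have := K.disjoint (flip v i) (i, v i) (by simp [Incident, flip_apply_self])
    rw [h0, abs_zero] at this
    linarith
  have n01 := inc 0 1 (by decide)
  have n02 := inc 0 2 (by decide)
  have n12 := inc 1 2 (by decide)
  have n00 := ninc 0
  have n11 := ninc 1
  have ht := K.base_tangent v (flip v 0) ⟨0, rfl⟩
  by_contra hne
  simp only [form_eq] at *
  have hv := (K.base v).inversiveForm_toVec_self
  have hn := (K.base (flip v 0)).inversiveForm_toVec_self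
  have g0 := (K.dual (0, v 0)).inversiveForm_toVec_self
  have g1 := (K.dual (1, v 1)).inversiveForm_toVec_self
  have g2 := (K.dual (2, v 2)).inversiveForm_toVec_self
  have hc := inversiveForm_comm
  set F := (K.dual (0, v 0)).toVec
  set G := (K.dual (1, v 1)).toVec
  set H := (K.dual (2, v 2)).toVec
  set b := (K.base v).toVec
  set n := (K.base (flip v 0)).toVec
  set p := inversiveForm F G
  set q := inversiveForm F H
  set r := inversiveForm G H
  have hpp : p * p = 1 := by rcases h01 with h | h <;> rw [h] <;> norm_num
  have hqq : q * q = 1 := by rcases h02 with h | h <;> rw [h] <;> norm_num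
  have hpqr : p * r * q = 1 := by
    refine Or.resolve_right ?_ hne
    rcases h01 with h | h <;> rcases h12 with h' | h' <;> rcases h02 with h'' | h'' <;>
      rw [h, h', h''] <;> norm_num
  -- after reorientation all three products are `1`, and the differences are null vectors
  have hm : p • G - q • H = 0 := by
    refine eq_zero_of_null_of_orthogonal (f := b + n) (g := F - p • G) ?_ ?_ ?_ ?_ ?_ ?_ <;>
      simp only [map_add, map_sub, map_smul, LinearMap.add_apply, LinearMap.sub_apply,
        LinearMap.smul_apply, smul_eq_mul, hv, hn, g0, g1, g2, ht, hc n b, f0, f1, n01, n02,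
        hc G F, hc H F, hc H G, hc G b, hc H b, f2, hc G n, hc H n]
    · ring
    · change 1 - p * p - p * (p - p * 1) = 0
      linear_combination -hpp
    · simpa using n00
    · change p * (p * 1 - q * r) - q * (p * r - q * 1) = 0
      linear_combination hpp + hqq - 2 * hpqr
    · simp
    · change p * p - q * q - p * (p * 1 - q * r) = 0
      linear_combination hpqr - hqq
  have := congrArg (inversiveForm (K.base (flip v 1)).toVec) hm
  simp only [map_sub, map_smul, smul_eq_mul, n12, mul_zero, sub_zero, map_zero, mul_eq_zero] at this
  rcases this with h0 | h0
  · rw [h0] at hpp; norm_num at hpp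
  · exact n11 h0

/-- The dual circles can be oriented coherently. -/
theorem exists_orientation : ∃ s : Face → ℝ, (∀ F, s F * s F = 1) ∧
    ∀ F F', FaceAdj F F' → s F * s F' * (K.dual F).form (K.dual F') = -1 := by
  let g : Face → Face → ℝ := fun F F' => (K.dual F).form (K.dual F')
  have hgs : ∀ F F', g F F' = g F' F := fun F F' =>
    inversiveForm_comm (K.dual F).toVec (K.dual F').toVec
  have hsq : ∀ F F', FaceAdj F F' → g F F' * g F F' = 1 := fun F F' h => by
    rcases eq_or_eq_neg_of_abs_eq (K.dual_tangent F F' h) with h | h <;>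
      simp only [g, h] <;> norm_num
  have tri : ∀ x y z, g (0, x) (1, y) * g (1, y) (2, z) * g (0, x) (2, z) = -1 := fun x y z =>
    K.dual_triangle ![x, y, z]
  have ha : ∀ x y, g (0, x) (1, y) * g (0, x) (1, y) = 1 :=
    fun x y => hsq _ _ (by simp [FaceAdj])
  have hb : ∀ y z, g (1, y) (2, z) * g (1, y) (2, z) = 1 :=
    fun x y => hsq _ _ (by simp [FaceAdj])
  have hc : ∀ x z, g (0, x) (2, z) * g (0, x) (2, z) = 1 :=
    fun x y => hsq _ _ (by simp [FaceAdj])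
  let s : Face → ℝ := fun F => if F.1 = 0 then g F (1, false) * g (0, false) (1, false)
    else -g (0, false) F
  have s0 : ∀ x, s (0, x) = g (0, x) (1, false) * g (0, false) (1, false) := fun x => rfl
  have s1 : ∀ y, s (1, y) = -g (0, false) (1, y) := fun y => rfl
  have s2 : ∀ z, s (2, z) = -g (0, false) (2, z) := fun z => rfl
  have e01 : ∀ x y, s (0, x) * s (1, y) * g (0, x) (1, y) = -1 := by
    intro x y
    have h1 := tri x y false
    have h2 := tri x false false
    have h3 := tri false y false
    have h4 := tri false false false
    have : (g (0, x) (1, false) * g (0, false) (1, false) * g (0, false) (1, y) *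
        g (0, x) (1, y)) = (g (1, y) (2, false) * g (1, y) (2, false)) *
        (g (1, false) (2, false) * g (1, false) (2, false)) *
        (g (0, x) (2, false) * g (0, x) (2, false)) *
        (g (0, false) (2, false) * g (0, false) (2, false)) *
        (g (0, x) (1, false) * g (0, false) (1, false) * g (0, false) (1, y) *
        g (0, x) (1, y)) := by
      rw [hb, hb, hc, hc]; ring
    rw [s0, s1]
    have h5 : (g (0, x) (1, false) * g (0, false) (1, false) * g (0, false) (1, y) *
        g (0, x) (1, y)) = 1 := by
      rw [this]
      calc _ = (g (0, x) (1, y) * g (1, y) (2, false) * g (0, x) (2, false)) *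
            (g (0, x) (1, false) * g (1, false) (2, false) * g (0, x) (2, false)) *
            (g (0, false) (1, y) * g (1, y) (2, false) * g (0, false) (2, false)) *
            (g (0, false) (1, false) * g (1, false) (2, false) * g (0, false) (2, false)) := by
              ring
        _ = 1 := by rw [h1, h2, h3, h4]; norm_num
    linear_combination -h5
  have e02 : ∀ x z, s (0, x) * s (2, z) * g (0, x) (2, z) = -1 := by
    intro x z
    have h1 := tri x false z
    have h2 := tri false false z
    rw [s0, s2]
    have h5 : g (0, x) (1, false) * g (0, false) (1, false) * g (0, false) (2, z) *
        g (0, x) (2, z) = 1 := by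
      calc _ = (g (1, false) (2, z) * g (1, false) (2, z)) *
            (g (0, x) (1, false) * g (0, false) (1, false) * g (0, false) (2, z) *
              g (0, x) (2, z)) := by rw [hb]; ring
        _ = (g (0, x) (1, false) * g (1, false) (2, z) * g (0, x) (2, z)) *
            (g (0, false) (1, false) * g (1, false) (2, z) * g (0, false) (2, z)) := by ring
        _ = 1 := by rw [h1, h2]; norm_num
    linear_combination -h5
  have e12 : ∀ y z, s (1, y) * s (2, z) * g (1, y) (2, z) = -1 := by
    intro y z
    rw [s1, s2]
    linear_combination tri false y z
  refine ⟨s, ?_, ?_⟩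
  · rintro ⟨i, x⟩
    fin_cases i
    · change s (0, x) * s (0, x) = 1
      rw [s0]
      linear_combination g (0, false) (1, false) * g (0, false) (1, false) * ha x false +
        ha false false
    · change s (1, x) * s (1, x) = 1
      rw [s1]; linear_combination ha false x
    · change s (2, x) * s (2, x) = 1
      rw [s2]; linear_combination hc false x
  · rintro ⟨i, x⟩ ⟨j, y⟩ hadj
    change s (i, x) * s (j, y) * g (i, x) (j, y) = -1
    fin_cases i <;> fin_cases j
    · exact absurd rfl hadj
    · exact e01 x y
    · exact e02 x y
    · rw [hgs, mul_comm (s _)]; exact e01 y x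
    · exact absurd rfl hadj
    · exact e12 x y
    · rw [hgs, mul_comm (s _)]; exact e02 y x
    · rw [hgs, mul_comm (s _)]; exact e12 y x
    · exact absurd rfl hadj

theorem exists_isCubeFrame : ∃ G : Face → Fin 4 → ℝ,
    IsCubeFrame (fun v => (K.base v).toVec) G ∧
      ∀ F, vecReflect (K.dual F).toVec = vecReflect (G F) := by
  obtain ⟨s, hs, hadj⟩ := K.exists_orientation
  have hs0 : ∀ F, s F ≠ 0 := fun F h0 => by
    have := hs F
    rw [h0] at this
    norm_num at this
  refine ⟨fun F => s F • (K.dual F).toVec, ⟨?_, ?_, ?_, ?_, ?_, ?_, ?_⟩, ?_⟩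
  · exact fun v => (K.base v).inversiveForm_toVec_self
  · exact fun v i => K.base_tangent v (flip v i) ⟨i, rfl⟩
  · intro F
    simp only [map_smul, LinearMap.smul_apply, smul_eq_mul, inversiveForm_toVec_self]
    linear_combination hs F
  · intro F F' h
    simp only [map_smul, LinearMap.smul_apply, smul_eq_mul]
    have := hadj F F' h
    rw [form_eq] at this
    linear_combination this
  · intro i t h1
    simp only [map_smul, LinearMap.smul_apply, smul_eq_mul] at h1
    have h2 := K.dual_disjoint (i, t) (i, !t) (by simp) (by simp [FaceAdj])
    rw [form_eq] at h2
    have h3 : inversiveForm (K.dual (i, t)).toVec (K.dual (i, !t)).toVec =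
        s (i, t) * s (i, !t) := by
      linear_combination s (i, t) * s (i, !t) * h1 -
        inversiveForm (K.dual (i, t)).toVec (K.dual (i, !t)).toVec *
          (hs (i, t) * (s (i, !t) * s (i, !t)) + hs (i, !t))
    rw [h3] at h2
    have h4 := one_lt_sq_iff_one_lt_abs _ |>.2 h2
    have h5 : (s (i, t) * s (i, !t)) ^ 2 = 1 := by
      linear_combination hs (i, t) * (s (i, !t) * s (i, !t)) + hs (i, !t)
    linarith
  · intro v i t h
    simp only [map_smul, smul_eq_mul]
    have := K.orthogonal v (i, t) h
    rw [form_eq] at this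
    rw [this, mul_zero]
  · intro v i t h
    simp only [map_smul, smul_eq_mul]
    have := K.disjoint v (i, t) h
    rw [form_eq] at this
    refine mul_ne_zero (hs0 _) fun h0 => ?_
    rw [h0, abs_zero] at this
    linarith
  · intro F
    refine LinearMap.ext fun x => ?_
    rw [vecReflect_apply, vecReflect_apply]
    ext t
    simp only [Pi.sub_apply, Pi.smul_apply, smul_eq_mul, map_smul]
    linear_combination 2 * inversiveForm x (K.dual F).toVec * (K.dual F).toVec t * hs F

/-- The linear forms giving the curvatures of the images of circles under an element of the
Apollonian group. -/
def IsCurvatureForm (φ : (Fin 4 → ℝ) →ₗ[ℝ] ℝ) : Prop :=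
  ∃ g ∈ K.group, ∀ C : OrientedCircle, (g C).curv = φ C.toVec

theorem isCurvatureForm_proj : K.IsCurvatureForm (LinearMap.proj 1) :=
  ⟨1, K.group.one_mem, fun _ => rfl⟩

variable {K} in
theorem IsCurvatureForm.comp_vecReflect {φ : (Fin 4 → ℝ) →ₗ[ℝ] ℝ} (h : K.IsCurvatureForm φ)
    (F : Face) : K.IsCurvatureForm (φ ∘ₗ vecReflect (K.dual F).toVec) := by
  obtain ⟨g, hg, hφ⟩ := h
  refine ⟨g * (K.dual F).reflection, K.group.mul_mem hg
    (Subgroup.subset_closure ⟨F, rfl⟩), fun C => ?_⟩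
  change (g (reflect (K.dual F) C)).curv = φ (vecReflect (K.dual F).toVec C.toVec)
  rw [hφ, toVec_reflect]

/-- Induction on words in the reflections, on the level of the linear forms. -/
theorem group_induction {P : ((Fin 4 → ℝ) →ₗ[ℝ] ℝ) → Prop} (h1 : P (LinearMap.proj 1))
    (hmul : ∀ φ F, P φ → P (φ ∘ₗ vecReflect (K.dual F).toVec)) {g : Equiv.Perm OrientedCircle}
    (hg : g ∈ K.group) : ∃ φ, P φ ∧ ∀ C : OrientedCircle, (g C).curv = φ C.toVec := by
  induction hg using Subgroup.closure_induction_right with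
  | one => exact ⟨_, h1, fun _ => rfl⟩
  | mul_right x hx y hy ih =>
    obtain ⟨φ, hφ, h⟩ := ih
    obtain ⟨F, rfl⟩ := hy
    refine ⟨_, hmul φ F hφ, fun C => ?_⟩
    change (x (reflect (K.dual F) C)).curv = φ (vecReflect (K.dual F).toVec C.toVec)
    rw [h, toVec_reflect]
  | mul_inv_cancel x hx y hy ih =>
    obtain ⟨φ, hφ, h⟩ := ih
    obtain ⟨F, rfl⟩ := hy
    refine ⟨_, hmul φ F hφ, fun C => ?_⟩
    change (x (reflect (K.dual F) C)).curv = φ (vecReflect (K.dual F).toVec C.toVec)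
    rw [h, toVec_reflect]

/-- Every vertex of the cube is reached from a given one along edges. -/
theorem vertex_induction {P : Vertex → Prop} {v : Vertex} (h : P v)
    (hflip : ∀ v i, P v → P (flip v i)) (w : Vertex) : P w := by
  have hup : ∀ u i x, P u → P (Function.update u i x) := by
    intro u i x hu
    by_cases hx : u i = x
    · rw [← hx, Function.update_eq_self]; exact hu
    · have : x = !(u i) := by
        revert hx; cases x <;> cases u i <;> simp
      rw [this]; exact hflip u i hu
  have : w = Function.update (Function.update (Function.update v 0 (w 0)) 1 (w 1)) 2 (w 2) := by
    ext i; fin_cases i <;> simp [Function.update]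
  rw [this]
  exact hup _ _ _ (hup _ _ _ (hup _ _ _ h))

section Curvatures

variable {φ : (Fin 4 → ℝ) →ₗ[ℝ] ℝ}

theorem map_base_flip_flip (φ : (Fin 4 → ℝ) →ₗ[ℝ] ℝ) (v : Vertex) {i j : Fin 3} (hij : i ≠ j) :
    φ (K.base (flip (flip v i) j)).toVec =
      φ (K.base (flip v i)).toVec + φ (K.base (flip v j)).toVec - φ (K.base v).toVec := by
  obtain ⟨G, hG, -⟩ := K.exists_isCubeFrame
  have := hG.base_flip_flip v hij
  rw [this, map_sub, map_add]

theorem map_vecReflect_of_incident (φ : (Fin 4 → ℝ) →ₗ[ℝ] ℝ) {v : Vertex} {F : Face}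
    (h : Incident v F) :
    φ (vecReflect (K.dual F).toVec (K.base v).toVec) = φ (K.base v).toVec := by
  have := K.orthogonal v F h
  rw [form_eq] at this
  rw [vecReflect_apply, this]
  simp

theorem map_vecReflect_flip (φ : (Fin 4 → ℝ) →ₗ[ℝ] ℝ) (v : Vertex) {i j k : Fin 3} (hij : i ≠ j)
    (hik : i ≠ k) (hjk : j ≠ k) :
    φ (vecReflect (K.dual (i, v i)).toVec (K.base (flip v i)).toVec) =
      2 * φ (K.base v).toVec + 2 * φ (K.base (flip v j)).toVec +
        2 * φ (K.base (flip v k)).toVec - φ (K.base (flip v i)).toVec := by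
  obtain ⟨G, hG, hr⟩ := K.exists_isCubeFrame
  have := hG.reflect_base v hij hik hjk
  rw [hr, vecReflect_apply, this]
  simp

/-- The values of `φ` at the vertex `v` and its neighbours in the directions `i`, `j`, `k`. -/
def HasValues (φ : (Fin 4 → ℝ) →ₗ[ℝ] ℝ) (v : Vertex) (i j k : Fin 3) (a b d e : ℤ) : Prop :=
  φ (K.base v).toVec = a ∧ φ (K.base (flip v i)).toVec = b ∧ φ (K.base (flip v j)).toVec = d ∧
    φ (K.base (flip v k)).toVec = e

variable {K} {v : Vertex} {i j k : Fin 3} {a b d e : ℤ}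

theorem HasValues.flip (h : K.HasValues φ v i j k a b d e) (hij : i ≠ j) (hik : i ≠ k) :
    K.HasValues φ (flip v i) i j k b a (b + d - a) (b + e - a) := by
  obtain ⟨h1, h2, h3, h4⟩ := h
  refine ⟨h2, by rw [flip_flip, h1], ?_, ?_⟩
  · rw [K.map_base_flip_flip φ v hij, h1, h2, h3]; push_cast; ring
  · rw [K.map_base_flip_flip φ v hik, h1, h2, h4]; push_cast; ring

theorem HasValues.reflect (h : K.HasValues φ v i j k a b d e) (hij : i ≠ j) (hik : i ≠ k)
    (hjk : j ≠ k) : K.HasValues (φ ∘ₗ vecReflect (K.dual (i, v i)).toVec) v i j k a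
      (2 * a + 2 * d + 2 * e - b) d e := by
  obtain ⟨h1, h2, h3, h4⟩ := h
  refine ⟨?_, ?_, ?_, ?_⟩ <;> rw [LinearMap.comp_apply]
  · rw [K.map_vecReflect_of_incident φ (by rfl), h1]
  · rw [K.map_vecReflect_flip φ v hij hik hjk, h1, h2, h3, h4]; push_cast; ring
  · rw [K.map_vecReflect_of_incident φ (by exact flip_apply_of_ne v hij), h3]
  · rw [K.map_vecReflect_of_incident φ (by exact flip_apply_of_ne v hik), h4]

variable {a₀ b₀ d₀ e₀ : ℤ} {v₀ : Vertex}

/-- Every reachable quadruple consists of curvatures of the packing. -/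
theorem mem_curvatures_of_reachable
    (h0 : K.HasValues (LinearMap.proj 1) v₀ 0 1 2 a₀ b₀ d₀ e₀)
    (h : ReachableOctuple a₀ b₀ d₀ e₀ a b d e) : a ∈ curvatures K.packing := by
  suffices H : ∃ φ v i j k, K.IsCurvatureForm φ ∧ i ≠ j ∧ i ≠ k ∧ j ≠ k ∧
      K.HasValues φ v i j k a b d e by
    obtain ⟨φ, v, -, -, -, ⟨g, hg, hφ⟩, -, -, -, ha, -⟩ := H
    exact ⟨g (K.base v), ⟨g, hg, v, rfl⟩, by rw [hφ, ha]⟩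
  induction h with
  | base => exact ⟨_, v₀, 0, 1, 2, K.isCurvatureForm_proj, by decide, by decide, by decide, h0⟩
  | swap _ ih =>
    obtain ⟨φ, v, i, j, k, hφ, hij, hik, hjk, h1, h2, h3, h4⟩ := ih
    exact ⟨φ, v, j, i, k, hφ, hij.symm, hjk, hik, h1, h3, h2, h4⟩
  | swap' _ ih =>
    obtain ⟨φ, v, i, j, k, hφ, hij, hik, hjk, h1, h2, h3, h4⟩ := ih
    exact ⟨φ, v, i, k, j, hφ, hik, hij, hjk.symm, h1, h2, h4, h3⟩
  | cross _ ih =>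
    obtain ⟨φ, v, i, j, k, hφ, hij, hik, hjk, h⟩ := ih
    exact ⟨φ, CubicPacking.flip v i, i, j, k, hφ, hij, hik, hjk, h.flip hij hik⟩
  | reflect _ ih =>
    obtain ⟨φ, v, i, j, k, hφ, hij, hik, hjk, h⟩ := ih
    exact ⟨_, v, i, j, k, hφ.comp_vecReflect _, hij, hik, hjk, h.reflect hij hik hjk⟩

/-- Every circle of the packing gives rise to a reachable quadruple. -/
theorem reachable_of_mem_curvatures
    (h0 : K.HasValues (LinearMap.proj 1) v₀ 0 1 2 a₀ b₀ d₀ e₀)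
    (h : a ∈ curvatures K.packing) : ∃ b d e, ReachableOctuple a₀ b₀ d₀ e₀ a b d e := by
  let P : ((Fin 4 → ℝ) →ₗ[ℝ] ℝ) → Vertex → Prop := fun φ v =>
    ∃ a b d e, K.HasValues φ v 0 1 2 a b d e ∧ ReachableOctuple a₀ b₀ d₀ e₀ a b d e
  have hflip : ∀ φ v i, P φ v → P φ (CubicPacking.flip v i) := by
    rintro φ v i ⟨a, b, d, e, ⟨h1, h2, h3, h4⟩, hr⟩
    fin_cases i
    · exact ⟨_, _, _, _, HasValues.flip ⟨h1, h2, h3, h4⟩ (by decide) (by decide), hr.cross⟩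
    · obtain ⟨k1, k2, k3, k4⟩ := HasValues.flip (K := K) (φ := φ) (v := v) (i := 1) (j := 0)
        (k := 2) ⟨h1, h3, h2, h4⟩ (by decide) (by decide)
      exact ⟨_, _, _, _, ⟨k1, k3, k2, k4⟩, hr.swap.cross.swap⟩
    · obtain ⟨k1, k2, k3, k4⟩ := HasValues.flip (K := K) (φ := φ) (v := v) (i := 2) (j := 0)
        (k := 1) ⟨h1, h4, h2, h3⟩ (by decide) (by decide)
      exact ⟨_, _, _, _, ⟨k1, k3, k4, k2⟩, hr.swap'.swap.cross.swap.swap'⟩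
  have hrefl : ∀ φ v i, P φ v → P (φ ∘ₗ vecReflect (K.dual (i, v i)).toVec) v := by
    rintro φ v i ⟨a, b, d, e, ⟨h1, h2, h3, h4⟩, hr⟩
    fin_cases i
    · exact ⟨_, _, _, _, HasValues.reflect ⟨h1, h2, h3, h4⟩ (by decide) (by decide) (by decide),
        hr.reflect⟩
    · obtain ⟨k1, k2, k3, k4⟩ := HasValues.reflect (K := K) (φ := φ) (v := v) (i := 1) (j := 0)
        (k := 2) ⟨h1, h3, h2, h4⟩ (by decide) (by decide) (by decide)
      exact ⟨_, _, _, _, ⟨k1, k3, k2, k4⟩, hr.swap.reflect.swap⟩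
    · obtain ⟨k1, k2, k3, k4⟩ := HasValues.reflect (K := K) (φ := φ) (v := v) (i := 2) (j := 0)
        (k := 1) ⟨h1, h4, h2, h3⟩ (by decide) (by decide) (by decide)
      exact ⟨_, _, _, _, ⟨k1, k3, k4, k2⟩, hr.swap'.swap.reflect.swap.swap'⟩
  obtain ⟨C, ⟨g, hg, w, rfl⟩, hC⟩ := h
  obtain ⟨φ, hP, hφ⟩ := K.group_induction (P := fun φ => ∀ v, P φ v)
    (vertex_induction ⟨_, _, _, _, h0, ReachableOctuple.base⟩ (hflip _))
    (fun φ F ih => by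
      -- a vertex incident with the face of the reflection
      have := hrefl φ (fun _ => F.2) F.1 (ih _)
      exact vertex_induction this (hflip _)) hg
  obtain ⟨a', b, d, e, ⟨h1, -⟩, hr⟩ := hP w
  have : a = a' := by
    rw [hφ, h1] at hC
    exact_mod_cast hC.symm
  subst this
  exact ⟨b, d, e, hr⟩

/-- The curvatures of a generating octuple satisfy the quadratic relation. -/
theorem curvature_relation (h0 : K.HasValues (LinearMap.proj 1) v₀ 0 1 2 a b d e) :
    (a + b + d - e) ^ 2 - 4 * (a + b) * (a + d) = -8 * a ^ 2 := by
  obtain ⟨G, hG, -⟩ := K.exists_isCubeFrame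
  -- the curvature is the product with the null vector of the point at infinity
  have hN : ∀ x : Fin 4 → ℝ, inversiveForm ![-2, 0, 0, 0] x = LinearMap.proj (R := ℝ)
      (φ := fun _ => ℝ) 1 x := by
    intro x; simp [inversiveForm_apply]; ring
  have := hG.null_relation (N := ![-2, 0, 0, 0]) (by simp [inversiveForm_apply]) v₀
  obtain ⟨h1, h2, h3, h4⟩ := h0
  simp only [hN, h1, h2, h3, h4] at this
  exact_mod_cast this

/-- The orientation of the base circles makes the sums of tangent curvatures nonnegative. -/
theorem curvature_add_nonneg (h0 : K.HasValues (LinearMap.proj 1) v₀ 0 1 2 a b d e)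
    (ha : a ≠ 0) : 0 ≤ a + b ∧ 0 ≤ a + d ∧ 0 ≤ a + e := by
  have hr := curvature_relation h0
  have hneg : ∀ u w : Vertex, u ≠ w → 0 ≤ (K.base u).curv ∨ 0 ≤ (K.base w).curv := by
    intro u w huw
    by_contra! hcon
    exact huw (K.oriented u w hcon.1 hcon.2)
  have hne : ∀ i j, i ≠ j → CubicPacking.flip v₀ i ≠ CubicPacking.flip v₀ j := by
    intro i j hij heq
    have := congrFun heq i
    rw [flip_apply_self, flip_apply_of_ne v₀ hij] at this
    simp at this
  have hne' : ∀ i, v₀ ≠ CubicPacking.flip v₀ i := by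
    intro i heq
    have := congrFun heq i
    rw [flip_apply_self] at this
    simp at this
  have c0 : (K.base v₀).curv = a := h0.1
  have c1 : (K.base (CubicPacking.flip v₀ 0)).curv = b := h0.2.1
  have c2 : (K.base (CubicPacking.flip v₀ 1)).curv = d := h0.2.2.1
  have n01 : 0 ≤ a ∨ 0 ≤ b := by
    have := hneg _ _ (hne' 0); rw [c0, c1] at this; exact_mod_cast this
  have n02 : 0 ≤ a ∨ 0 ≤ d := by
    have := hneg _ _ (hne' 1); rw [c0, c2] at this; exact_mod_cast this
  have n12 : 0 ≤ b ∨ 0 ≤ d := by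
    have := hneg _ _ (hne 0 1 (by decide)); rw [c1, c2] at this; exact_mod_cast this
  have ha2 : 0 < a ^ 2 := by positivity
  have p01 : 0 < (a + b) * (a + d) := by nlinarith [sq_nonneg (a + b + d - e)]
  have p02 : 0 < (a + b) * (a + e) := by nlinarith [sq_nonneg (a + b + e - d)]
  have hpos : 0 < a + b := by
    by_contra! hle
    have h1 : a + b < 0 := lt_of_le_of_ne hle fun h => by rw [h] at p01; simp at p01
    have h2 : a + d < 0 := by nlinarith
    have ha' : a < 0 := by omega
    have h3 : 0 < b + (b + d - a) := by omega
    have h4 : 4 * ((a + b) * (b + (b + d - a))) = (a + b + d - e) ^ 2 + 8 * b ^ 2 := by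
      linear_combination -hr
    nlinarith [sq_nonneg (a + b + d - e), sq_nonneg b]
  refine ⟨hpos.le, ?_, ?_⟩
  · exact ((pos_iff_pos_of_mul_pos p01).1 hpos).le
  · exact ((pos_iff_pos_of_mul_pos p02).1 hpos).le

theorem octupleSystem (h0 : K.HasValues (LinearMap.proj 1) v₀ 0 1 2 a b d e) (ha : a ≠ 0)
    (hprim : IsPrimitive K.packing) (htype : IsType012 K.packing) :
    OctupleSystem (ReachableOctuple a b d e) := by
  obtain ⟨n1, n2, n3⟩ := curvature_add_nonneg h0 ha
  refine ReachableOctuple.octupleSystem (curvature_relation h0) n1 n2 n3 ?_ ?_ ?_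
  · intro g h1 h2 h3 h4
    refine hprim g fun n hn => ?_
    obtain ⟨b', d', e', hr⟩ := reachable_of_mem_curvatures h0 hn
    suffices H : ∀ {a' b' d' e'}, ReachableOctuple a b d e a' b' d' e' →
        g ∣ a' ∧ g ∣ b' ∧ g ∣ d' ∧ g ∣ e' from (H hr).1
    intro a' b' d' e' hr
    induction hr with
    | base => exact ⟨h1, h2, h3, h4⟩
    | swap _ ih => exact ⟨ih.1, ih.2.2.1, ih.2.1, ih.2.2.2⟩
    | swap' _ ih => exact ⟨ih.1, ih.2.1, ih.2.2.2, ih.2.2.1⟩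
    | cross _ ih =>
      exact ⟨ih.2.1, ih.1, dvd_sub (dvd_add ih.2.1 ih.2.2.1) ih.1,
        dvd_sub (dvd_add ih.2.1 ih.2.2.2) ih.1⟩
    | reflect _ ih =>
      exact ⟨ih.1, dvd_sub (dvd_add (dvd_add (ih.1.mul_left 2) (ih.2.2.1.mul_left 2))
        (ih.2.2.2.mul_left 2)) ih.2.1, ih.2.2.1, ih.2.2.2⟩
  · -- otherwise all curvatures have the same parity
    intro h1 h2 h3
    have H : ∀ {a' b' d' e'}, ReachableOctuple a b d e a' b' d' e' →
        2 ∣ a' - a ∧ 2 ∣ a' + b' ∧ 2 ∣ a' + d' ∧ 2 ∣ a' + e' := by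
      intro a' b' d' e' hr
      induction hr with
      | base => exact ⟨by simp, h1, h2, h3⟩
      | _ h ih => omega
    have m0 : (0 : ℤ) ∈ (fun n : ℤ => n % 4) '' curvatures K.packing := by
      rw [htype]; simp
    have m1 : (1 : ℤ) ∈ (fun n : ℤ => n % 4) '' curvatures K.packing := by
      rw [htype]; simp
    obtain ⟨x, hx, hx4⟩ := m0
    obtain ⟨y, hy, hy4⟩ := m1
    obtain ⟨_, _, _, hx'⟩ := reachable_of_mem_curvatures h0 hx
    obtain ⟨_, _, _, hy'⟩ := reachable_of_mem_curvatures h0 hy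
    have k1 := (H hx').1
    have k2 := (H hy').1
    simp only at hx4 hy4
    omega
  · intro a' b' d' e' hr
    have : a' % 4 ∈ (fun n : ℤ => n % 4) '' curvatures K.packing :=
      ⟨a', mem_curvatures_of_reachable h0 hr, rfl⟩
    rw [htype] at this
    simpa using this

end Curvatures

end CubicConfiguration

/-- In a packing without lines, infinitely many squares satisfy the modular restrictions. -/
theorem exists_admissible_sq {K : CubicConfiguration} {v : Vertex} {a₀ b₀ d₀ e₀ : ℤ}
    (h0 : K.HasValues (LinearMap.proj 1) v 0 1 2 a₀ b₀ d₀ e₀)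
    (hS : OctupleSystem (ReachableOctuple a₀ b₀ d₀ e₀)) (htype : IsType012 K.packing)
    (hne : 0 ∉ curvatures K.packing) (N : ℤ) :
    ∃ n : ℤ, N ≤ n ^ 2 ∧ IsAdmissible K.packing (n ^ 2) := by
  have m0 : (0 : ℤ) ∈ (fun n : ℤ => n % 4) '' curvatures K.packing := by
    rw [htype]; simp
  obtain ⟨a, ha, ha4⟩ := m0
  have ha0 : a ≠ 0 := by rintro rfl; exact hne ha
  obtain ⟨b, d, e, hr⟩ := CubicConfiguration.reachable_of_mem_curvatures h0 ha
  simp only at ha4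
  obtain ⟨b, d, e, hr, hb⟩ : ∃ b d e, ReachableOctuple a₀ b₀ d₀ e₀ a b d e ∧ Odd b := by
    have hp := hS.parity hr
    by_cases hb : Odd b
    · exact ⟨b, d, e, hr, hb⟩
    by_cases hd : Odd d
    · exact ⟨d, b, e, hr.swap, hd⟩
    refine ⟨e, b, d, hr.swap'.swap, ?_⟩
    rw [Int.odd_iff] at *
    omega
  obtain ⟨q, rfl⟩ := Int.dvd_of_emod_eq_zero ha4
  have hq : q ≠ 0 := by rintro rfl; simp at ha0
  refine ⟨6 * q * (2 * |N| + 1), ?_, fun m hm => ?_⟩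
  · have h1 : 1 ≤ q ^ 2 := by
      have : 0 < q ^ 2 := by positivity
      omega
    have h2 := abs_nonneg N
    have h3 := le_abs_self N
    have h4 : (6 * q * (2 * |N| + 1)) ^ 2 = 36 * q ^ 2 * (2 * |N| + 1) ^ 2 := by ring
    rw [h4]
    nlinarith [sq_nonneg (2 * |N| + 1)]
  · lift m to ℕ using hm.le
    obtain ⟨c, b', d', e', hc, hdvd⟩ := hS.exists_congr hr (Int.even_iff.2 (by omega)) hb
      (t := (6 * q * (2 * |N| + 1)) ^ 2) (by
        obtain ⟨w, hw⟩ := (Int.even_mul_succ_self q)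
        refine ⟨w - 5 * q ^ 2 - 18 * q ^ 2 * (|N| ^ 2 + |N|), ?_⟩
        linear_combination 4 * hw) (by
        intro p hp hp2 hd
        have hp' := Nat.prime_iff_prime_int.1 hp
        have h2 : ¬ (p : ℤ) ∣ 2 := fun hc =>
          hp2 ((Nat.prime_dvd_prime_iff_eq hp Nat.prime_two).1 (by exact_mod_cast hc))
        have h4 : ¬ (p : ℤ) ∣ 2 ^ 2 := fun hc => h2 (hp'.dvd_of_dvd_pow hc)
        have h3q : (p : ℤ) ∣ 3 * q := by
          have : (3 * (4 * q) : ℤ) = 2 ^ 2 * (3 * q) := by ring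
          rw [this] at hd
          exact (hp'.dvd_or_dvd hd).resolve_left h4
        have : (6 * q * (2 * |N| + 1)) ^ 2 = (3 * q) * (2 * (2 * |N| + 1) *
            (6 * q * (2 * |N| + 1))) := by ring
        rw [this]
        exact h3q.mul_right _) (m := m) (by omega)
    exact ⟨c, CubicConfiguration.mem_curvatures_of_reachable h0 hc,
      (Int.modEq_iff_dvd.2 (by rw [← dvd_neg]; simpa using hdvd))⟩

end CubicPacking

theorem mainTheorem3 (A : Set CubicPacking.OrientedCircle)
    (hA : CubicPacking.IsCubicPacking A)
    (hint : CubicPacking.IsIntegral A)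
    (hprim : CubicPacking.IsPrimitive A)
    (htype : CubicPacking.IsType012 A)
    (hchi : CubicPacking.PackingChi A (-1)) :
    (∀ n : ℤ, n ^ 2 ∉ CubicPacking.curvatures A ∧ 2 * n ^ 2 ∉ CubicPacking.curvatures A) ∧
      ¬ CubicPacking.LocalGlobal A := by
  obtain ⟨C, -, K, v, a, b, d, e, x, y, rfl, -, ha, hb, hd, he, ha0, hxy, -, hcop, hchi⟩ := hchi
  have h0 : K.HasValues (LinearMap.proj 1) v 0 1 2 a b d e := ⟨ha, hb, hd, he⟩
  have hS := CubicPacking.CubicConfiguration.octupleSystem h0 ha0 hprim htype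
  have key : ∀ n : ℤ, n ^ 2 ∉ CubicPacking.curvatures K.packing ∧
      2 * n ^ 2 ∉ CubicPacking.curvatures K.packing := by
    intro n
    constructor <;> intro hn <;>
      obtain ⟨_, _, _, hr⟩ :=
        CubicPacking.CubicConfiguration.reachable_of_mem_curvatures h0 hn
    · exact (CubicPacking.ReachableOctuple.not_sq hS ha0 ⟨x, y, hxy, hcop, hchi⟩ hr n).1 rfl
    · exact (CubicPacking.ReachableOctuple.not_sq hS ha0 ⟨x, y, hxy, hcop, hchi⟩ hr n).2 rfl
  refine ⟨key, ?_⟩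
  rintro ⟨N, hN⟩
  obtain ⟨n, hn, hadm⟩ := CubicPacking.exists_admissible_sq h0 hS htype
    (by simpa using (key 0).1) N
  exact (key n).1 (hN _ hn hadm)
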